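/- Let $f:[0,1]\to(0,1)$ be of class $C^3$. An urn process associated to $f$ is a Markov chain $((\alpha_n,l_n))_{n\ge 0}$ on $[0,1]\times(0,\infty)$ such that $l_{n+1}=l_n+1$ and, given the past, $\alpha_{n+1}=\frac{l_n\alpha_n+1}{l_n+1}$ (a Red draw) with probability $f(\alpha_n)$ and $\alpha_{n+1}=\frac{l_n\alpha_n}{l_n+1}$ with probability $1-f(\alpha_n)$. Let $w_0=(\alpha_0^x,l_0^x)_{x\in\mathbb Z}\in([0,1]\times(0,\infty))^{\mathbb Z}$, and let $((\alpha^x_n,l^x_n))_{n\ge 0}$, $x\in\mathbb Z$, be independent urn processes associated to $f$, started from $(\alpha_0^x,l_0^x)$. The generalized reinforced random walk $(X_n)_{n\ge0}$ on $\mathbb Z$ starts at $X_0=0$; at its $(k+1)$-st visit to a site $x$ it jumps to $x+1$ if the $(k+1)$-st draw of the urn at $x$ is Red, and to $x-1$ otherwise. Let $R$ be the event that $X$ visits every site infinitely often, and for $x\in\mathbb Z$ put $$\delta_n^x=\sum_{k=0}^{n}(2f(\alpha_k^x)-1),\qquad \delta_\infty^x=\lim_{n\to\infty}\delta_n^x .$$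 Theorem. Assume that $w_0^x=w_0^1$ for all $x\ge 1$ and $w_0^x=w_0^{-1}$ for all $x\le -1$, and that $f$ has a unique fixed point $p\in[0,1]$. (1) If $p\ne 1/2$, then $\mathbb P[R]=0$. (2) If $p=1/2$ and $f'(1/2)=0$, then each of the conditions $\mathbb E[\delta^1_\infty]>1$ and $\mathbb E[\delta^{-1}_\infty]<-1$ implies $\mathbb P[R]=0$. Moreover, both in case (1) and in case (2) (before any condition on the expectations), for every $x\in\mathbb Z$ the quantities $\delta^x_\infty$ and $\mathbb E[\delta^x_\infty]$ are well defined: almost surely $\delta^x_n$ converges in $[-\infty,\infty]$, at least one of $\mathbb E\big[\sum_{k\ge0}(2f(\alpha_k^x)-1)_+\big]$ and $\mathbb E\big[\sum_{k\ge0}(2f(\alpha_k^x)-1)_-\big]$ is finite, and hence $\mathbb E[\delta_\infty^x]\in[-\infty,\infty]$ exists. -/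

import Mathlib

open MeasureTheory Filter Topology

noncomputable section

namespace RRW

/-- The state `(α, l)` of an urn: proportion of Red balls and total number of balls. -/
abbrev UrnState := ℝ × ℝ

/-- One draw from an urn in state `(α, l)`, driven by a number `u` which will be uniform on `[0,1]`:
a Red ball is drawn when `u < f α` (hence with probability `f α`), and then `α` becomes
`(l α + 1) / (l + 1)`; otherwise `α` becomes `l α / (l + 1)`. In both cases `l` becomes `l + 1`. -/
def urnStep (f : ℝ → ℝ) (u : unitInterval) (s : UrnState) : UrnState :=
  if (u : ℝ) < f s.1 then ((s.2 * s.1 + 1) / (s.2 + 1), s.2 + 1)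
  else (s.2 * s.1 / (s.2 + 1), s.2 + 1)

/-- The urn process `((α_n, l_n), n ≥ 0)` associated to `f`, started from `s` and driven by the
sequence `u`. If `u` is i.i.d. uniform, this is the Markov chain with the urn transitions. -/
def urn (f : ℝ → ℝ) (s : UrnState) (u : ℕ → unitInterval) : ℕ → UrnState
  | 0 => s
  | n + 1 => urnStep f (u n) (urn f s u n)

/-- Sample points: a sequence of numbers in `[0,1]` for every site of `ℤ`. -/
abbrev Sample := ℤ → ℕ → unitInterval

/-- All coordinates are independent and uniform on `[0,1]`; thus the urns attached to the sites
are independent. -/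
def sampleMeasure : Measure Sample :=
  Measure.infinitePi fun _ : ℤ => Measure.infinitePi fun _ : ℕ => (volume : Measure unitInterval)

/-- The proportion `α_k^x` of the urn at site `x` after `k` draws, when the initial environment
is `w`. -/
def alpha (f : ℝ → ℝ) (w : ℤ → UrnState) (ω : Sample) (x : ℤ) (k : ℕ) : ℝ :=
  (urn f (w x) (ω x) k).1

/-- The pair `(X_n, L_n)` formed by the position of the walk and the local times
`L_n^x = #{k < n : X_k = x}`. The walk starts at `0`; when it is at `x` for the `(k+1)`-st time,
it draws from the urn at `x` for the `(k+1)`-st time, and jumps to `x + 1` if the ball is Red and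
to `x - 1` otherwise. -/
def walkState (f : ℝ → ℝ) (w : ℤ → UrnState) (ω : Sample) : ℕ → ℤ × (ℤ → ℕ)
  | 0 => (0, fun _ => 0)
  | n + 1 =>
    let x := (walkState f w ω n).1
    let L := (walkState f w ω n).2
    (if (ω x (L x) : ℝ) < f (alpha f w ω x (L x)) then x + 1 else x - 1,
      Function.update L x (L x + 1))

/-- The generalized reinforced random walk `X_n` associated to `f`, started at `(0, w)`. -/
def walk (f : ℝ → ℝ) (w : ℤ → UrnState) (ω : Sample) (n : ℕ) : ℤ :=
  (walkState f w ω n).1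

/-- The event of recurrence: every site is visited infinitely often. -/
def recurrence (f : ℝ → ℝ) (w : ℤ → UrnState) : Set Sample :=
  {ω | ∀ x : ℤ, ∃ᶠ n in atTop, walk f w ω n = x}

/-- The drift `δ_n^x = ∑_{k=0}^n (2 f(α_k^x) - 1)`. -/
def drift (f : ℝ → ℝ) (w : ℤ → UrnState) (x : ℤ) (n : ℕ) (ω : Sample) : ℝ :=
  ∑ k ∈ Finset.range (n + 1), (2 * f (alpha f w ω x k) - 1)

/-- `δ_∞^x`, the limit in `[-∞, ∞]` of `δ_n^x` (written as a lower limit, which is the limit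
whenever the limit exists). -/
def driftLimit (f : ℝ → ℝ) (w : ℤ → UrnState) (x : ℤ) (ω : Sample) : EReal :=
  liminf (fun n : ℕ => (drift f w x n ω : EReal)) atTop

/-- `∑_{k≥0} (2 f(α_k^x) - 1)_+`. -/
def driftPos (f : ℝ → ℝ) (w : ℤ → UrnState) (x : ℤ) (ω : Sample) : ENNReal :=
  ∑' k : ℕ, ENNReal.ofReal (2 * f (alpha f w ω x k) - 1)

/-- `∑_{k≥0} (2 f(α_k^x) - 1)_-`. -/
def driftNeg (f : ℝ → ℝ) (w : ℤ → UrnState) (x : ℤ) (ω : Sample) : ENNReal :=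
  ∑' k : ℕ, ENNReal.ofReal (-(2 * f (alpha f w ω x k) - 1))

/-- The expectation of an extended-real random variable `Y` is well defined:
`E[Y_+] < ∞` or `E[Y_-] < ∞`. -/
def HasExpectation {Ω : Type*} [MeasurableSpace Ω] (μ : Measure Ω) (Y : Ω → EReal) : Prop :=
  ∫⁻ ω, (Y ω).toENNReal ∂μ < ⊤ ∨ ∫⁻ ω, (-Y ω).toENNReal ∂μ < ⊤

/-- The expectation `E[Y] = E[Y_+] - E[Y_-] ∈ [-∞, ∞]` of an extended-real random variable;
meaningful under `HasExpectation`. -/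
def expectation {Ω : Type*} [MeasurableSpace Ω] (μ : Measure Ω) (Y : Ω → EReal) : EReal :=
  ((∫⁻ ω, (Y ω).toENNReal ∂μ : ENNReal) : EReal) - ((∫⁻ ω, (-Y ω).toENNReal ∂μ : ENNReal) : EReal)

/-- `δ_∞^x` and `E[δ_∞^x]` are well defined: `δ_n^x` converges a.s. in `[-∞, ∞]`, the positive or
the negative part of the accumulated drift has finite mean, and the expectation of the limit
exists in `[-∞, ∞]`. -/
def DriftWellDefined (f : ℝ → ℝ) (w : ℤ → UrnState) (x : ℤ) : Prop :=
  (∀ᵐ ω ∂sampleMeasure,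
    Tendsto (fun n : ℕ => (drift f w x n ω : EReal)) atTop (𝓝 (driftLimit f w x ω))) ∧
  (∫⁻ ω, driftPos f w x ω ∂sampleMeasure < ⊤ ∨ ∫⁻ ω, driftNeg f w x ω ∂sampleMeasure < ⊤) ∧
  HasExpectation sampleMeasure (driftLimit f w x)

end RRW

end

namespace RRW

open ProbabilityTheory
open scoped ENNReal

/-! ### Coloured draws at a single site -/

/-! Transience comes from counting left jumps on one half-line, where the urns are i.i.d. While the
walk stands at or to the left of a site `x ≥ 0`, it has jumped from `x` to `x + 1` exactly as often
as from `x + 1` to `x`. If `x + 1` has produced `j` left jumps when a far level is first reached,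
then the left jumps from `x` number the failures before the `(j + 1)`-st Red draw at `x`. This gives
the chain `backward`, started from `0` at the far level and run towards the origin; it is Markov
because the urns are i.i.d.

Stopping the compensated draws at the `(j + 1)`-st Red one (`IsCompensated.lintegral_failures`)
shows that the mean of the next value is `j + 1` minus the mean drift accumulated until then. If the
mean total drift exceeds `1`, the chain thus loses a fixed `η` in mean once `j ≥ K`
(`exists_lintegral_failures_le`). A nonnegative quantity cannot decrease forever, so for infinitely
many `n` the chain is below `K` with probability bounded below, and from there one step leads to `0`
with positive probability. Monotonicity in the level and Kolmogorov's zero-one law yield a site at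
which the chain vanishes for every level (`ae_exists_backward_eq_zero`). A recurrent walk crosses
every edge to the left, which excludes this (`exists_backward_ne_zero`). The negative half-line
follows by reflection and exchange of colours.

It remains to control the drift. All means are kept in `ℝ≥0∞`: `meanSum` sees only the positive part
of its argument, so the two signs of the drift are summed separately. Potentials of the form (a
power of `l`) times (a power of the excess over a point) show that the urn spends a finite mean time
away from the unique fixed point `p` (`meanSum_far`). If `p ≠ 1/2`, the increments near `p` have
constant sign and are bounded away from `0`, so the mean drift is infinite and the criterion
applies. If `p = 1/2` and `f' = 0` there, either `f'' ≠ 0` and `f` has a local extremum, so that one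
sign of the drift occurs only away from `p`, or `f'' = 0` and the increments are at most cubic in
the deviation; cubes of deviations are summable in mean (`meanSum_cube`), in accordance with the
heuristic order `k ^ (-1/2)` of the deviation. -/

/-- The number of Red balls among the first `k` draws. -/
def reds (b : ℕ → Bool) (k : ℕ) : ℕ := Nat.count (fun i => b i = true) k

/-- The number of Red balls is infinite. -/
def InfinitelyRed (b : ℕ → Bool) : Prop := {k | b k = true}.Infinite

/-- The number of draws of the other colour before the `(j + 1)`-st Red draw. -/
noncomputable def failures (b : ℕ → Bool) (j : ℕ) : ℕ := Nat.nth (fun i => b i = true) j - j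

lemma reds_zero (b : ℕ → Bool) : reds b 0 = 0 := by simp [reds]

lemma reds_succ (b : ℕ → Bool) (k : ℕ) :
    reds b (k + 1) = reds b k + if b k = true then 1 else 0 := by
  simp [reds, Nat.count_succ]

lemma reds_le (b : ℕ → Bool) (k : ℕ) : reds b k ≤ k := Nat.count_le _

lemma reds_mono (b : ℕ → Bool) : Monotone (reds b) := Nat.count_monotone _

lemma sub_reds_mono (b : ℕ → Bool) : Monotone fun k => k - reds b k := by
  refine monotone_nat_of_le_succ fun k => ?_
  have := reds_le b k
  rw [reds_succ]
  split_ifs <;> omega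

lemma reds_le_iff {b : ℕ → Bool} (hb : InfinitelyRed b) {k j : ℕ} :
    reds b k ≤ j ↔ k ≤ Nat.nth (fun i => b i = true) j :=
  Nat.count_le_iff_le_nth hb

lemma failures_eq {b : ℕ → Bool} (hb : InfinitelyRed b) (j : ℕ) :
    failures b j = Nat.nth (fun i => b i = true) j
      - reds b (Nat.nth (fun i => b i = true) j) := by
  rw [failures, reds, Nat.count_nth_of_infinite hb]

lemma le_failures {b : ℕ → Bool} (hb : InfinitelyRed b) {k j : ℕ} (h : reds b k ≤ j) :
    k - reds b k ≤ failures b j := by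
  rw [failures_eq hb]
  exact sub_reds_mono b ((reds_le_iff hb).1 h)

lemma failures_mono {b : ℕ → Bool} (hb : InfinitelyRed b) : Monotone (failures b) := by
  intro i j hij
  rw [failures_eq hb, failures_eq hb]
  exact sub_reds_mono b (Nat.nth_monotone hb hij)

/-- This is the way back to `0`: an initial run of `K` Red draws sends every state of the chain
below `K` to `0` in one step. -/
lemma failures_eq_zero {b : ℕ → Bool} {K j : ℕ} (h : reds b K = K) (hj : j < K) :
    failures b j = 0 := by
  have hall : ∀ i < K, b i = true := by
    have := (Nat.count_iff_forall (p := fun i => b i = true)).1 h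
    intro i hi
    exact this i hi
  rw [failures, Nat.nth_of_forall fun n hn => hall n (lt_of_le_of_lt hn hj)]
  simp

lemma infinitelyRed_of_forall {b : ℕ → Bool} (h : ∀ j, ∃ k, j < reds b k) : InfinitelyRed b := by
  intro hfin
  obtain ⟨M, hM⟩ := hfin.bddAbove
  obtain ⟨k, hk⟩ := h (M + 1)
  have : ∀ k, reds b k ≤ M + 1 := by
    intro k
    induction k with
    | zero => simp [reds_zero]
    | succ k ih =>
      rw [reds_succ]
      split_ifs with hbk
      · have h1 : k ≤ M := hM hbk
        have := reds_le b k
        omega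
      · simpa using ih
  exact absurd hk (not_lt.2 (this k))

/-- The condition `reds b k ≤ j` says that draw `k` comes no later than the `(j + 1)`-st Red one. It
depends only on earlier draws, hence stopping turns into a sum of predictable indicators. The `+ 1`
counts the last Red draw itself. -/
lemma sum_red_indicator (b : ℕ → Bool) (j m : ℕ) :
    ∑ k ∈ Finset.range m, (if reds b k ≤ j ∧ b k = true then 1 else 0) = min (reds b m) (j + 1) := by
  induction m with
  | zero => simp [reds_zero]
  | succ m ih =>
    rw [Finset.sum_range_succ, ih, reds_succ]
    split_ifs <;> simp_all <;> omega

lemma sum_not_red_indicator (b : ℕ → Bool) (m : ℕ) :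
    ∑ k ∈ Finset.range m, (if b k = false then 1 else 0) = m - reds b m := by
  induction m with
  | zero => simp
  | succ m ih =>
    have := reds_le b m
    rw [Finset.sum_range_succ, ih, reds_succ]
    cases b m <;> simp; omega

lemma tsum_red_indicator {b : ℕ → Bool} (hb : InfinitelyRed b) (j : ℕ) :
    ∑' k, (if reds b k ≤ j ∧ b k = true then (1 : ℝ≥0∞) else 0) = j + 1 := by
  set N := Nat.nth (fun i => b i = true) j
  rw [tsum_eq_sum (s := Finset.range (N + 1))]
  · have h := sum_red_indicator b j (N + 1)
    have h2 : reds b (N + 1) = j + 1 := Nat.count_nth_succ_of_infinite hb j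
    rw [h2, min_self] at h
    exact_mod_cast congrArg (Nat.cast (R := ℝ≥0∞)) h
  · intro k hk
    simp only [Finset.mem_range, not_lt] at hk
    refine if_neg fun h => ?_
    have := (reds_le_iff hb).1 h.1
    omega

lemma tsum_not_red_indicator {b : ℕ → Bool} (hb : InfinitelyRed b) (j : ℕ) :
    ∑' k, (if reds b k ≤ j ∧ b k = false then (1 : ℝ≥0∞) else 0) = failures b j := by
  set N := Nat.nth (fun i => b i = true) j with hN
  rw [tsum_eq_sum (s := Finset.range (N + 1))]
  · have h := sum_not_red_indicator b (N + 1)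
    have h2 : reds b (N + 1) = j + 1 := Nat.count_nth_succ_of_infinite hb j
    rw [h2, Nat.add_sub_add_right] at h
    rw [failures, ← hN, ← h]
    push_cast
    refine Finset.sum_congr rfl fun k hk => ?_
    have : reds b k ≤ j := (reds_le_iff hb).2 (by simp at hk; omega)
    simp [this]
  · intro k hk
    simp only [Finset.mem_range, not_lt] at hk
    refine if_neg fun h => ?_
    have := (reds_le_iff hb).1 h.1
    omega

lemma measurable_reds (k : ℕ) : Measurable fun b : ℕ → Bool => reds b k := by
  induction k with
  | zero => simp [reds_zero]
  | succ k ih =>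
    simp only [reds_succ]
    refine ih.add (Measurable.ite ?_ measurable_const measurable_const)
    exact measurableSet_eq_fun (measurable_pi_apply k) measurable_const

lemma measurable_failures (j : ℕ) : Measurable fun b : ℕ → Bool => failures b j := by
  have key : Measurable fun b : ℕ → Bool => Nat.nth (fun i => b i = true) j := by
    -- `Nat.nth` also takes the value `0` by default when there are too few Red draws, so only the
    -- fibres over `m ≠ 0` have a clean description; the fibre over `0` is then obtained as a
    -- complement.
    have hpos : ∀ m : ℕ, m ≠ 0 →
        MeasurableSet ((fun b : ℕ → Bool => Nat.nth (fun i => b i = true) j) ⁻¹' {m}) := by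
      intro m hm
      have : (fun b : ℕ → Bool => Nat.nth (fun i => b i = true) j) ⁻¹' {m}
          = {b | b m = true} ∩ {b | reds b m = j} := by
        ext b
        simp only [Set.mem_preimage, Set.mem_singleton_iff, Set.mem_inter_iff, Set.mem_ofPred_eq]
        constructor
        · intro h
          have h0 : Nat.nth (fun i => b i = true) j ≠ 0 := by omega
          refine ⟨by simpa [h] using Nat.nth_mem_of_ne_zero h0, ?_⟩
          have := Nat.count_nth (p := fun i => b i = true) (n := j)
            (fun hf => Nat.lt_card_toFinset_of_nth_ne_zero h0 hf)
          rwa [h] at this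
        · rintro ⟨h1, h2⟩
          rw [← h2]
          exact Nat.nth_count (p := fun i => b i = true) h1
      rw [this]
      exact (measurableSet_eq_fun (measurable_pi_apply m) measurable_const).inter
        (measurableSet_eq_fun (measurable_reds m) measurable_const)
    refine measurable_to_countable' fun m => ?_
    by_cases hm : m = 0
    · subst hm
      have : (fun b : ℕ → Bool => Nat.nth (fun i => b i = true) j) ⁻¹' {0}
          = (⋃ m : ℕ,
            (fun b : ℕ → Bool => Nat.nth (fun i => b i = true) j) ⁻¹' {m + 1})ᶜ := by
        ext b
        simp only [Set.mem_preimage, Set.mem_singleton_iff, Set.mem_compl_iff, Set.mem_iUnion,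
          not_exists]
        constructor
        · intro h m
          omega
        · intro h
          by_contra h0
          exact h (Nat.nth (fun i => b i = true) j - 1) (by omega)
      rw [this]
      exact (MeasurableSet.iUnion fun m => hpos (m + 1) (by omega)).compl
    · exact hpos m hm
  exact (measurable_of_countable (fun n : ℕ => n - j)).comp key

/-! ### Compensated draws and the mean number of failures. -/

variable {S : Type*} [MeasurableSpace S]

/-- The draws `r` at a site are Red with predictable probabilities `φ`, bounded below by `ε`, in the
sense that `φ` compensates the draws on every event that is determined by the number of Red draws
made so far. -/
structure IsCompensated (μ : Measure S) (r : S → ℕ → Bool) (φ : ℕ → S → ℝ) (ε : ℝ) : Prop where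
  measurable_draw : Measurable r
  measurable_rate : ∀ k, Measurable (φ k)
  pos : 0 < ε
  le_rate : ∀ k s, ε ≤ φ k s
  rate_le : ∀ k s, φ k s ≤ 1
  red : ∀ (k : ℕ) (T : Set ℕ), μ {s | reds (r s) k ∈ T ∧ r s k = true} =
    ∫⁻ s in {s | reds (r s) k ∈ T}, ENNReal.ofReal (φ k s) ∂μ
  not_red : ∀ (k : ℕ) (T : Set ℕ), μ {s | reds (r s) k ∈ T ∧ r s k = false} =
    ∫⁻ s in {s | reds (r s) k ∈ T}, ENNReal.ofReal (1 - φ k s) ∂μ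

namespace IsCompensated

variable {μ : Measure S} {r : S → ℕ → Bool} {φ : ℕ → S → ℝ} {ε : ℝ}

lemma measurableSet_reds (h : IsCompensated μ r φ ε) (k : ℕ) (T : Set ℕ) :
    MeasurableSet {s | reds (r s) k ∈ T} :=
  ((measurable_reds k).comp h.measurable_draw) (MeasurableSet.of_discrete (s := T))

lemma measurableSet_draw (h : IsCompensated μ r φ ε) (k : ℕ) (c : Bool) :
    MeasurableSet {s | r s k = c} :=
  ((measurable_pi_apply k).comp h.measurable_draw) (measurableSet_singleton c)

lemma le_measure_red (h : IsCompensated μ r φ ε) (k : ℕ) (T : Set ℕ) :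
    ENNReal.ofReal ε * μ {s | reds (r s) k ∈ T} ≤ μ {s | reds (r s) k ∈ T ∧ r s k = true} := by
  rw [h.red, ← setLIntegral_const]
  exact lintegral_mono fun s => ENNReal.ofReal_le_ofReal (h.le_rate k s)

lemma measure_indicator (h : IsCompensated μ r φ ε) (k j : ℕ) (c : Bool) :
    ∫⁻ s, (if reds (r s) k ≤ j ∧ r s k = c then (1 : ℝ≥0∞) else 0) ∂μ =
      μ {s | reds (r s) k ∈ Set.Iic j ∧ r s k = c} := by
  have hm : MeasurableSet {s | reds (r s) k ∈ Set.Iic j ∧ r s k = c} :=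
    (h.measurableSet_reds k (Set.Iic j)).inter (h.measurableSet_draw k c)
  rw [← lintegral_indicator_one hm]
  refine lintegral_congr fun s => ?_
  simp [Set.indicator_apply]

lemma measurable_indicator (h : IsCompensated μ r φ ε) (k j : ℕ) (c : Bool) :
    Measurable fun s => if reds (r s) k ≤ j ∧ r s k = c then (1 : ℝ≥0∞) else 0 :=
  Measurable.ite ((h.measurableSet_reds k (Set.Iic j)).inter (h.measurableSet_draw k c))
    measurable_const measurable_const

/-- The sum is the mean waiting time for the `(j + 1)`-st Red draw. Each draw made while waiting is
Red with probability at least `ε`, and at most `j + 1` of them are Red. -/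
lemma tsum_measure_reds_ne_top [IsProbabilityMeasure μ] (h : IsCompensated μ r φ ε) (j : ℕ) :
    ∑' k, μ {s | reds (r s) k ∈ Set.Iic j} ≠ ⊤ := by
  have hbound : ∀ s, ∑' k, (if reds (r s) k ≤ j ∧ r s k = true then (1 : ℝ≥0∞) else 0)
      ≤ j + 1 := by
    intro s
    refine ENNReal.tsum_le_of_sum_range_le fun m => ?_
    have := sum_red_indicator (r s) j m
    calc ∑ k ∈ Finset.range m, (if reds (r s) k ≤ j ∧ r s k = true then (1 : ℝ≥0∞) else 0)
        = ((min (reds (r s) m) (j + 1) : ℕ) : ℝ≥0∞) := by rw [← this]; push_cast; rfl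
      _ ≤ ((j + 1 : ℕ) : ℝ≥0∞) := by exact_mod_cast min_le_right _ _
      _ = j + 1 := by push_cast; rfl
  have h1 : ENNReal.ofReal ε * ∑' k, μ {s | reds (r s) k ∈ Set.Iic j} ≤ j + 1 := by
    rw [← ENNReal.tsum_mul_left]
    calc _ ≤ ∑' k, μ {s | reds (r s) k ∈ Set.Iic j ∧ r s k = true} :=
          ENNReal.tsum_le_tsum fun k => h.le_measure_red k _
      _ = ∫⁻ s, ∑' k, (if reds (r s) k ≤ j ∧ r s k = true then (1 : ℝ≥0∞) else 0) ∂μ := by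
          rw [lintegral_tsum fun k => (h.measurable_indicator k j true).aemeasurable]
          exact tsum_congr fun k => (h.measure_indicator k j true).symm
      _ ≤ ∫⁻ _, (j + 1 : ℝ≥0∞) ∂μ := lintegral_mono hbound
      _ = j + 1 := by simp
  intro htop
  rw [htop, ENNReal.mul_top (by simpa using h.pos)] at h1
  exact absurd h1 (by simp)

/-- Borel–Cantelli, since the waiting times have finite mean. -/
lemma ae_infinitelyRed [IsProbabilityMeasure μ] (h : IsCompensated μ r φ ε) :
    ∀ᵐ s ∂μ, InfinitelyRed (r s) := by
  have : ∀ᵐ s ∂μ, ∀ j : ℕ, {k | reds (r s) k ∈ Set.Iic j}.Finite :=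
    ae_all_iff.2 fun j => ae_finite_setOfPred_mem (h.tsum_measure_reds_ne_top j)
  filter_upwards [this] with s hs
  refine infinitelyRed_of_forall fun j => ?_
  obtain ⟨k, hk⟩ := (hs j).exists_notMem
  exact ⟨k, by simpa using hk⟩

/-- Balance between the mean number of failures before the `(j + 1)`-st Red draw and the drift
accumulated until that draw. -/
lemma lintegral_failures [IsProbabilityMeasure μ] (h : IsCompensated μ r φ ε) (j : ℕ) :
    ∫⁻ s, (failures (r s) j : ℝ≥0∞) ∂μ +
        ∑' k, ∫⁻ s in {s | reds (r s) k ∈ Set.Iic j}, ENNReal.ofReal (2 * φ k s - 1) ∂μ =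
      j + 1 +
        ∑' k, ∫⁻ s in {s | reds (r s) k ∈ Set.Iic j}, ENNReal.ofReal (-(2 * φ k s - 1)) ∂μ := by
  have h1 : ∫⁻ s, (failures (r s) j : ℝ≥0∞) ∂μ =
      ∑' k, ∫⁻ s in {s | reds (r s) k ∈ Set.Iic j}, ENNReal.ofReal (1 - φ k s) ∂μ := by
    calc _ = ∫⁻ s, ∑' k, (if reds (r s) k ≤ j ∧ r s k = false then (1 : ℝ≥0∞) else 0) ∂μ := by
          refine lintegral_congr_ae ?_
          filter_upwards [h.ae_infinitelyRed] with s hs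
          rw [tsum_not_red_indicator hs]
      _ = _ := by
          rw [lintegral_tsum fun k => (h.measurable_indicator k j false).aemeasurable]
          exact tsum_congr fun k => by rw [h.measure_indicator, h.not_red]
  have h2 : (j + 1 : ℝ≥0∞) =
      ∑' k, ∫⁻ s in {s | reds (r s) k ∈ Set.Iic j}, ENNReal.ofReal (φ k s) ∂μ := by
    calc (j + 1 : ℝ≥0∞) = ∫⁻ _, (j + 1 : ℝ≥0∞) ∂μ := by simp
      _ = ∫⁻ s, ∑' k, (if reds (r s) k ≤ j ∧ r s k = true then (1 : ℝ≥0∞) else 0) ∂μ := by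
          refine lintegral_congr_ae ?_
          filter_upwards [h.ae_infinitelyRed] with s hs
          rw [tsum_red_indicator hs]
      _ = _ := by
          rw [lintegral_tsum fun k => (h.measurable_indicator k j true).aemeasurable]
          exact tsum_congr fun k => by rw [h.measure_indicator, h.red]
  rw [h1, h2, ← ENNReal.tsum_add, ← ENNReal.tsum_add]
  refine tsum_congr fun k => ?_
  have hm := h.measurable_rate k
  rw [← lintegral_add_left (by fun_prop), ← lintegral_add_left (by fun_prop)]
  -- Pointwise, `(1 - φ) + (2φ - 1)₊ = φ + (2φ - 1)₋`. Written additively, the balance needs no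
  -- integrability.
  refine lintegral_congr fun s => ?_
  have hp : 0 ≤ φ k s := h.pos.le.trans (h.le_rate k s)
  have hq := h.rate_le k s
  rcases le_total 0 (2 * φ k s - 1) with h0 | h0
  · rw [ENNReal.ofReal_of_nonpos (neg_nonpos.2 h0), add_zero,
      ← ENNReal.ofReal_add (by linarith) h0]
    congr 1; ring
  · rw [ENNReal.ofReal_of_nonpos h0, add_zero, ← ENNReal.ofReal_add hp (by linarith)]
    congr 1; ring

lemma measure_all_red_pos [IsProbabilityMeasure μ] (h : IsCompensated μ r φ ε) (K : ℕ) :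
    0 < μ {s | reds (r s) K = K} := by
  induction K with
  | zero => simp [reds_zero]
  | succ K ih =>
    have h1 := h.le_measure_red K {K}
    have h2 : μ {s | reds (r s) K ∈ ({K} : Set ℕ) ∧ r s K = true}
        ≤ μ {s | reds (r s) (K + 1) = K + 1} := by
      refine measure_mono fun s hs => ?_
      obtain ⟨ha, hb⟩ := hs
      simp only [Set.mem_singleton_iff] at ha
      simp [reds_succ, ha, hb]
    refine lt_of_lt_of_le ?_ (h1.trans h2)
    exact ENNReal.mul_pos (by simpa using h.pos) ih.ne'

/-- If the mean of the total drift is larger than `1`, the mean number of failures before the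
`(j + 1)`-st Red draw is eventually smaller than `j` by a margin. -/
lemma exists_lintegral_failures_le [IsProbabilityMeasure μ] (h : IsCompensated μ r φ ε)
    (hd : 1 + ∑' k, ∫⁻ s, ENNReal.ofReal (-(2 * φ k s - 1)) ∂μ
      < ∑' k, ∫⁻ s, ENNReal.ofReal (2 * φ k s - 1) ∂μ) :
    ∃ (K : ℕ) (η C : ℝ≥0∞), 0 < η ∧ η ≠ ⊤ ∧ C ≠ ⊤ ∧ ∀ j : ℕ,
      ∫⁻ s, (failures (r s) j : ℝ≥0∞) ∂μ + η ≤ j + if j < K then C else 0 := by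
  set N := ∑' k, ∫⁻ s, ENNReal.ofReal (-(2 * φ k s - 1)) ∂μ with hN
  -- `θ` lies strictly between the two sides, and finitely many terms of the positive drift already
  -- exceed it.
  obtain ⟨θ, hθ1, hθ2⟩ := exists_between hd
  have hNtop : 1 + N ≠ ⊤ := (hθ1.trans_le le_top).ne
  have hθtop : θ ≠ ⊤ := (hθ2.trans_le le_top).ne
  have hη : 1 + N + (θ - (1 + N)) = θ := add_tsub_cancel_of_le hθ1.le
  obtain ⟨K, hK⟩ : ∃ K, θ < ∑ k ∈ Finset.range K,
      ∫⁻ s, ENNReal.ofReal (2 * φ k s - 1) ∂μ :=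
    ((ENNReal.tendsto_nat_tsum _).eventually (lt_mem_nhds hθ2)).exists
  have hneg : ∀ j : ℕ, ∑' k, ∫⁻ s in {s | reds (r s) k ∈ Set.Iic j},
      ENNReal.ofReal (-(2 * φ k s - 1)) ∂μ ≤ N := fun j =>
    ENNReal.tsum_le_tsum fun k => setLIntegral_le_lintegral _ _
  -- For `j < K` only the crude bound `j + 1 + N` is available, so `C` has to absorb `1 + N` and the
  -- margin.
  refine ⟨K, θ - (1 + N), 1 + N + (θ - (1 + N)), tsub_pos_of_lt hθ1,
    ENNReal.sub_ne_top hθtop, by rwa [hη], fun j => ?_⟩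
  have hb := h.lintegral_failures j
  split_ifs with hj
  · rw [← add_assoc]
    gcongr
    calc _ ≤ _ := le_self_add
      _ = _ := hb
      _ ≤ j + 1 + N := by gcongr; exact hneg j
      _ = _ := by ring
  · have hpos : θ ≤ ∑' k, ∫⁻ s in {s | reds (r s) k ∈ Set.Iic j},
        ENNReal.ofReal (2 * φ k s - 1) ∂μ := by
      refine hK.le.trans ((Finset.sum_le_sum fun k hk => ?_).trans
        (ENNReal.sum_le_tsum (Finset.range K)))
      -- For `k < K ≤ j` there cannot be more than `j` Red draws yet, so the restriction is void and
      -- the whole term counts.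
      have : {s | reds (r s) k ∈ Set.Iic j} = Set.univ := by
        ext s
        have := reds_le (r s) k
        simp at hk ⊢
        omega
      rw [this, setLIntegral_univ]
    have h3 : ∫⁻ s, (failures (r s) j : ℝ≥0∞) ∂μ + (θ - (1 + N)) + (1 + N) ≤ j + (1 + N) := by
      calc _ = ∫⁻ s, (failures (r s) j : ℝ≥0∞) ∂μ + θ := by rw [add_assoc, add_comm (_ - _), hη]
        _ ≤ _ := add_le_add_right hpos _
        _ = _ := hb
        _ ≤ j + 1 + N := by gcongr; exact hneg j
        _ = _ := by ring
    simpa using (ENNReal.add_le_add_iff_right hNtop).1 h3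

end IsCompensated

/-! ### The backward chain of left crossings -/

/-- `backward b n i` is the number of jumps from `i` to `i - 1` before the level `i + n` is reached
from the left, for a walk which follows the draws `b` and is sent back to `i` from `i - 1`. -/
noncomputable def backward (b : ℕ → ℕ → Bool) : ℕ → ℕ → ℕ
  | 0, _ => 0
  | n + 1, i => failures (b i) (backward b n (i + 1))

/-- A farther target leaves room for more left jumps; the start value `0` is the smallest one and
`failures` is monotone. -/
lemma backward_le_succ {b : ℕ → ℕ → Bool} (hb : ∀ i, InfinitelyRed (b i)) (n i : ℕ) :
    backward b n i ≤ backward b (n + 1) i := by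
  induction n generalizing i with
  | zero => exact Nat.zero_le _
  | succ n ih => exact failures_mono (hb i) (ih (i + 1))

lemma measurable_failures_uncurry : Measurable fun q : (ℕ → Bool) × ℕ => failures q.1 q.2 :=
  measurable_from_prod_countable_left fun j => measurable_failures j

/-- Only the sites from `i` on are used. This gives the independence from the earlier sites as well
as the tail event of the zero-one law. -/
lemma measurable_backward_tail {Ω : Type*} (B : ℕ → Ω → ℕ → Bool) (n i : ℕ) :
    Measurable[⨆ k ∈ Set.Ici i, MeasurableSpace.comap (B k) inferInstance]
      fun ω => backward (fun k => B k ω) n i := by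
  induction n generalizing i with
  | zero => exact @measurable_const _ _ _ _ _
  | succ n ih =>
    have h1 : Measurable[⨆ k ∈ Set.Ici i, MeasurableSpace.comap (B k) inferInstance]
        fun ω => backward (fun k => B k ω) n (i + 1) :=
      (ih (i + 1)).mono (biSup_mono fun k hk => by simp at hk ⊢; omega) le_rfl
    have h2 : Measurable[⨆ k ∈ Set.Ici i, MeasurableSpace.comap (B k) inferInstance] (B i) :=
      (comap_measurable (B i)).mono
        (le_biSup (fun k => MeasurableSpace.comap (B k) inferInstance) (by simp)) le_rfl
    exact measurable_failures_uncurry.comp (h2.prodMk h1)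

section Chain

variable {Ω : Type*} [mΩ : MeasurableSpace Ω] {P : Measure Ω}
  {B : ℕ → Ω → ℕ → Bool} {ν : Measure (ℕ → Bool)}

lemma tail_le (hB : ∀ i, Measurable (B i)) (i : ℕ) :
    (⨆ k ∈ Set.Ici i, MeasurableSpace.comap (B k) inferInstance) ≤ mΩ :=
  iSup₂_le fun k _ => (hB k).comap_le

lemma measurable_backward (hB : ∀ i, Measurable (B i)) (n i : ℕ) :
    Measurable fun ω => backward (fun k => B k ω) n i :=
  (measurable_backward_tail B n i).mono (tail_le hB i) le_rfl

lemma indepFun_backward (hB : ∀ i, Measurable (B i)) (hind : iIndepFun B P) (n i : ℕ) :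
    IndepFun (B i) (fun ω => backward (fun k => B k ω) n (i + 1)) P := by
  have h := indep_iSup_of_disjoint (fun k => (hB k).comap_le) hind
    (S := {i}) (T := Set.Ici (i + 1)) (by simp)
  rw [IndepFun_iff_Indep]
  refine indep_of_indep_of_le_left (indep_of_indep_of_le_right h ?_) ?_
  · exact (measurable_backward_tail B n (i + 1)).comap_le
  · exact le_biSup (fun k => MeasurableSpace.comap (B k) inferInstance) (Set.mem_singleton i)

variable [IsProbabilityMeasure P]

lemma map_backward (hB : ∀ i, Measurable (B i)) (hind : iIndepFun B P)
    (hlaw : ∀ i, P.map (B i) = ν) (n i : ℕ) :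
    P.map (fun ω => (B i ω, backward (fun k => B k ω) n (i + 1))) =
      ν.prod (P.map fun ω => backward (fun k => B k ω) n (i + 1)) := by
  rw [(indepFun_iff_map_prod_eq_prod_map_map (hB i).aemeasurable
    (measurable_backward hB n (i + 1)).aemeasurable).1 (indepFun_backward hB hind n i), hlaw]

/-- Because the law does not depend on the site, raising the level by one at a fixed site is in law
one step of a single Markov chain. -/
lemma map_backward_eq (hB : ∀ i, Measurable (B i)) (hind : iIndepFun B P)
    (hlaw : ∀ i, P.map (B i) = ν) (n i i' : ℕ) :
    (P.map fun ω => backward (fun k => B k ω) n i) =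
      P.map fun ω => backward (fun k => B k ω) n i' := by
  induction n generalizing i i' with
  | zero => rfl
  | succ n ih =>
    have key : ∀ i, (P.map fun ω => backward (fun k => B k ω) (n + 1) i) =
        (ν.prod (P.map fun ω => backward (fun k => B k ω) n (i + 1))).map
          (fun q => failures q.1 q.2) := by
      intro i
      rw [← map_backward hB hind hlaw, Measure.map_map measurable_failures_uncurry
        ((hB i).prodMk (measurable_backward hB n (i + 1)))]
      rfl
    rw [key, key, ih (i + 1) (i' + 1)]

lemma measure_backward_eq (hB : ∀ i, Measurable (B i)) (hind : iIndepFun B P)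
    (hlaw : ∀ i, P.map (B i) = ν) (n i i' : ℕ) (T : Set ℕ) :
    P {ω | backward (fun k => B k ω) n i ∈ T} = P {ω | backward (fun k => B k ω) n i' ∈ T} := by
  have h := congrArg (fun m => m T) (map_backward_eq hB hind hlaw n i i')
  rw [Measure.map_apply (measurable_backward hB n i) (MeasurableSet.of_discrete (s := T)),
    Measure.map_apply (measurable_backward hB n i') (MeasurableSet.of_discrete (s := T))] at h
  exact h

/-- The one-step drift inequality integrated over the current state, which is independent of the
draws at site `0`. -/
lemma lintegral_backward_succ (hB : ∀ i, Measurable (B i)) (hind : iIndepFun B P)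
    (hlaw : ∀ i, P.map (B i) = ν) [IsProbabilityMeasure ν] {K : ℕ} {η C : ℝ≥0∞}
    (hdrift : ∀ j : ℕ, ∫⁻ b, (failures b j : ℝ≥0∞) ∂ν + η ≤ j + if j < K then C else 0)
    (n : ℕ) :
    ∫⁻ ω, (backward (fun k => B k ω) (n + 1) 0 : ℝ≥0∞) ∂P + η ≤
      ∫⁻ ω, (backward (fun k => B k ω) n 0 : ℝ≥0∞) ∂P +
        C * P {ω | backward (fun k => B k ω) n 0 < K} := by
  set z := P.map fun ω => backward (fun k => B k ω) n 1 with hz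
  have hmz := measurable_backward hB n 1
  have : IsProbabilityMeasure z := Measure.isProbabilityMeasure_map hmz.aemeasurable
  have hz0 : z = P.map fun ω => backward (fun k => B k ω) n 0 := map_backward_eq hB hind hlaw n 1 0
  have hm0 := measurable_backward hB n 0
  have hcast : Measurable fun q : (ℕ → Bool) × ℕ => (failures q.1 q.2 : ℝ≥0∞) :=
    (measurable_of_countable (fun n : ℕ => (n : ℝ≥0∞))).comp measurable_failures_uncurry
  have h1 : ∫⁻ ω, (backward (fun k => B k ω) (n + 1) 0 : ℝ≥0∞) ∂P =
      ∫⁻ j, ∫⁻ b, (failures b j : ℝ≥0∞) ∂ν ∂z := by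
    rw [← lintegral_prod_symm' _ hcast, hz, ← map_backward hB hind hlaw,
      lintegral_map hcast ((hB 0).prodMk hmz)]
    rfl
  have h2 : ∫⁻ ω, (backward (fun k => B k ω) n 0 : ℝ≥0∞) ∂P = ∫⁻ j, (j : ℝ≥0∞) ∂z := by
    rw [hz0, lintegral_map (measurable_of_countable _) hm0]
  have h3 : P {ω | backward (fun k => B k ω) n 0 < K} = z (Set.Iio K) := by
    rw [hz0, Measure.map_apply hm0 MeasurableSet.of_discrete]
    rfl
  have h4 : C * z (Set.Iio K) = ∫⁻ j, (if j < K then C else 0) ∂z := by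
    rw [← lintegral_indicator_const MeasurableSet.of_discrete]
    refine lintegral_congr fun j => ?_
    simp [Set.indicator_apply]
  rw [h1, h2, h3, h4, ← lintegral_add_left (measurable_of_countable _)]
  calc _ = ∫⁻ j, ((∫⁻ b, (failures b j : ℝ≥0∞) ∂ν) + η) ∂z := by
        rw [lintegral_add_right _ measurable_const]; simp
    _ ≤ _ := lintegral_mono hdrift

/-- Foster's argument: were the chain eventually unlikely to lie below `K`, its finite mean would
drop by `η / 2` at every step. -/
lemma frequently_le_measure_backward (hB : ∀ i, Measurable (B i)) (hind : iIndepFun B P)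
    (hlaw : ∀ i, P.map (B i) = ν) [IsProbabilityMeasure ν] {K : ℕ} {η C : ℝ≥0∞}
    (hη : 0 < η) (hηtop : η ≠ ⊤) (hC : C ≠ ⊤)
    (hdrift : ∀ j : ℕ, ∫⁻ b, (failures b j : ℝ≥0∞) ∂ν + η ≤ j + if j < K then C else 0) :
    ∃ c : ℝ≥0∞, 0 < c ∧ ∃ᶠ n in atTop, c ≤ P {ω | backward (fun k => B k ω) n 0 < K} := by
  set e : ℕ → ℝ≥0∞ := fun n => ∫⁻ ω, (backward (fun k => B k ω) n 0 : ℝ≥0∞) ∂P with he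
  have hstep := lintegral_backward_succ hB hind hlaw hdrift
  have hfin : ∀ n, e n ≠ ⊤ := by
    intro n
    induction n with
    | zero => simp [he, backward]
    | succ n ih =>
      refine ne_top_of_le_ne_top ?_ (le_self_add.trans (hstep n))
      exact ENNReal.add_ne_top.2 ⟨ih, ENNReal.mul_ne_top hC (measure_ne_top _ _)⟩
  -- Chosen so that the correction `C * P(chain < K)` stays below `η / 2`; `C + 1` avoids dividing
  -- by zero.
  refine ⟨η / 2 / (C + 1), ENNReal.div_pos (ENNReal.half_pos hη.ne').ne'
    (ENNReal.add_ne_top.2 ⟨hC, ENNReal.one_ne_top⟩), ?_⟩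
  by_contra hcon
  rw [not_frequently, eventually_atTop] at hcon
  obtain ⟨n₀, hn₀⟩ := hcon
  have hdec : ∀ n ≥ n₀, e (n + 1) + η / 2 ≤ e n := by
    intro n hn
    have hlt := not_le.1 (hn₀ n hn)
    have hCle : C * P {ω | backward (fun k => B k ω) n 0 < K} ≤ η / 2 := by
      calc _ ≤ (C + 1) * (η / 2 / (C + 1)) := mul_le_mul' le_self_add hlt.le
        _ ≤ η / 2 := ENNReal.mul_div_le
    have h2 : e (n + 1) + η / 2 + η / 2 ≤ e n + η / 2 := by
      rw [add_assoc, ENNReal.add_halves]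
      exact (hstep n).trans (add_le_add_right hCle _)
    exact (ENNReal.add_le_add_iff_right (ENNReal.div_ne_top hηtop (by simp))).1 h2
  have hsum : ∀ m : ℕ, e (n₀ + m) + m * (η / 2) ≤ e n₀ := by
    intro m
    induction m with
    | zero => simp
    | succ m ih =>
      refine le_trans (le_of_eq ?_) ((add_le_add_left (hdec (n₀ + m) (by omega)) _).trans ih)
      push_cast
      rw [add_assoc n₀ m 1]
      ring
  obtain ⟨m, hm⟩ := ENNReal.exists_nat_mul_gt (ENNReal.half_pos hη.ne').ne' (hfin n₀)
  exact absurd ((le_add_self).trans (hsum m)) (not_le.2 hm)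

lemma mul_le_measure_backward_succ (hB : ∀ i, Measurable (B i)) (hind : iIndepFun B P)
    (hlaw : ∀ i, P.map (B i) = ν) (n i K : ℕ) :
    ν {b | reds b K = K} * P {ω | backward (fun k => B k ω) n 0 < K} ≤
      P {ω | backward (fun k => B k ω) (n + 1) i = 0} := by
  have h1 := (indepFun_backward hB hind n i).measure_inter_preimage_eq_mul {b | reds b K = K}
    (Set.Iio K) (measurableSet_eq_fun (measurable_reds K) measurable_const)
    MeasurableSet.of_discrete
  rw [← hlaw i, Measure.map_apply (hB i)
    (measurableSet_eq_fun (measurable_reds K) measurable_const)]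
  have h2 := measure_backward_eq hB hind hlaw n 0 (i + 1) (Set.Iio K)
  calc _ = P (B i ⁻¹' {b | reds b K = K}) *
        P ((fun ω => backward (fun k => B k ω) n (i + 1)) ⁻¹' Set.Iio K) := by
        congr 1
    _ = _ := h1.symm
    _ ≤ _ := measure_mono fun ω hω => failures_eq_zero hω.1 hω.2

/-- If the mean of the backward chain decreases by a margin as long as the chain is large, then
almost surely some site is never crossed back, whatever the level to be reached. -/
theorem ae_exists_backward_eq_zero (hB : ∀ i, Measurable (B i)) (hind : iIndepFun B P)
    (hlaw : ∀ i, P.map (B i) = ν) [IsProbabilityMeasure ν]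
    (hinf : ∀ᵐ b ∂ν, InfinitelyRed b) (hred : ∀ K : ℕ, 0 < ν {b | reds b K = K})
    {K : ℕ} {η C : ℝ≥0∞} (hη : 0 < η) (hηtop : η ≠ ⊤) (hC : C ≠ ⊤)
    (hdrift : ∀ j : ℕ, ∫⁻ b, (failures b j : ℝ≥0∞) ∂ν + η ≤ j + if j < K then C else 0) :
    ∀ᵐ ω ∂P, ∃ i, ∀ n, backward (fun k => B k ω) n i = 0 := by
  obtain ⟨c, hc, hfreq⟩ := frequently_le_measure_backward hB hind hlaw hη hηtop hC hdrift
  set q := ν {b | reds b K = K} * c with hq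
  have hq0 : 0 < q := ENNReal.mul_pos (hred K).ne' hc.ne'
  have hinf' : ∀ᵐ ω ∂P, ∀ i, InfinitelyRed (B i ω) :=
    ae_all_iff.2 fun i => by
      have := hinf
      rw [← hlaw i] at this
      exact ae_of_ae_map (hB i).aemeasurable this
  have hmz : ∀ n i, MeasurableSet {ω | backward (fun k => B k ω) n i = 0} := fun n i =>
    measurableSet_eq_fun (measurable_backward hB n i) measurable_const
  -- The lower bound holds at infinitely many levels; as vanishing at a level forces vanishing at
  -- lower ones, it holds at all levels.
  have hge : ∀ n i, q ≤ P {ω | backward (fun k => B k ω) n i = 0} := by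
    intro n i
    obtain ⟨m, hm, hcm⟩ := (frequently_atTop.1 hfreq) n
    refine (mul_le_mul_right hcm _).trans
      ((mul_le_measure_backward_succ hB hind hlaw m i K).trans (measure_mono_ae ?_))
    filter_upwards [hinf'] with ω hω h0
    have hmono : Monotone fun n => backward (fun k => B k ω) n i :=
      monotone_nat_of_le_succ fun n => backward_le_succ hω n i
    exact Nat.le_zero.1 ((hmono (by omega : n ≤ m + 1)).trans h0.le)
  set A : ℕ → Set Ω := fun i => {ω | ∀ n, backward (fun k => B k ω) n i = 0} with hA
  have hAtail : ∀ i, MeasurableSet[⨆ k ∈ Set.Ici i,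
      MeasurableSpace.comap (B k) inferInstance] (A i) := by
    intro i
    have : A i = ⋂ n, {ω | backward (fun k => B k ω) n i = 0} := by ext; simp [hA]
    rw [this]
    exact MeasurableSet.iInter fun n =>
      (measurable_backward_tail B n i) (MeasurableSet.of_discrete (s := {0}))
  have hAm : ∀ i, MeasurableSet (A i) := fun i => tail_le hB i _ (hAtail i)
  have hAq : ∀ i, q ≤ P (A i) := by
    intro i
    have hAe : A i = ⋂ n, ⋂ m ∈ Set.Iic n, {ω | backward (fun k => B k ω) m i = 0} := by
      ext ω
      simp only [hA, Set.mem_ofPred_eq, Set.mem_iInter, Set.mem_Iic]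
      exact ⟨fun h n m _ => h m, fun h n => h n n le_rfl⟩
    have hlim := tendsto_measure_iInter_atTop (μ := P)
      (s := fun n => ⋂ m ∈ Set.Iic n, {ω | backward (fun k => B k ω) m i = 0})
      (fun n => (MeasurableSet.biInter (Set.to_countable _) fun m _ => hmz m i).nullMeasurableSet)
      (fun a b hab => Set.biInter_subset_biInter_left (Set.Iic_subset_Iic.2 hab))
      ⟨0, measure_ne_top _ _⟩
    rw [hAe]
    refine ge_of_tendsto' hlim fun n => (hge n i).trans (measure_mono_ae ?_)
    filter_upwards [hinf'] with ω hω h0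
    have hmono : Monotone fun n => backward (fun k => B k ω) n i :=
      monotone_nat_of_le_succ fun n => backward_le_succ hω n i
    refine Set.mem_iInter₂.2 fun m hm => Nat.le_zero.1 ((hmono hm).trans h0.le)
  -- That infinitely many of the `A i` occur is a tail event, since `A i` depends only on the sites
  -- from `i` on. Its probability is at least `q > 0`, hence `1`.
  have hT : MeasurableSet[limsup (fun k => MeasurableSpace.comap (B k) inferInstance) atTop]
      (⋂ n, ⋃ i ∈ Set.Ici n, A i) := by
    rw [limsup_eq_iInf_iSup_of_nat, MeasurableSpace.measurableSet_iInf]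
    intro n
    have : (⋂ n, ⋃ i ∈ Set.Ici n, A i) = ⋂ m, ⋃ i ∈ Set.Ici (n + m), A i := by
      ext ω
      simp only [Set.mem_iInter]
      refine ⟨fun h m => h (n + m), fun h m => ?_⟩
      exact Set.biUnion_subset_biUnion_left (Set.Ici_subset_Ici.2 (by omega)) (h m)
    rw [this]
    refine MeasurableSet.iInter fun m => MeasurableSet.biUnion (Set.to_countable _) fun i hi => ?_
    refine (biSup_mono (fun k hk => ?_) :
      (⨆ k ∈ Set.Ici i, MeasurableSpace.comap (B k) inferInstance) ≤ _) _ (hAtail i)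
    simp at hi hk ⊢
    omega
  have h01 := measure_zero_or_one_of_measurableSet_limsup_atTop
    (fun k => (hB k).comap_le) hind hT
  have hTq : q ≤ P (⋂ n, ⋃ i ∈ Set.Ici n, A i) := by
    have hlim := tendsto_measure_iInter_atTop (μ := P)
      (s := fun n => ⋃ i ∈ Set.Ici n, A i)
      (fun n => (MeasurableSet.biUnion (Set.to_countable _) fun m _ => hAm m).nullMeasurableSet)
      (fun a b hab => Set.biUnion_subset_biUnion_left (Set.Ici_subset_Ici.2 hab))
      ⟨0, measure_ne_top _ _⟩
    exact ge_of_tendsto' hlim fun n => (hAq n).trans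
      (measure_mono (Set.subset_biUnion_of_mem (u := A) (Set.mem_Ici.2 le_rfl)))
  have h1 : P (⋂ n, ⋃ i ∈ Set.Ici n, A i) = 1 :=
    h01.resolve_left (hq0.trans_le hTq).ne'
  have hmT : MeasurableSet (⋂ n, ⋃ i ∈ Set.Ici n, A i) :=
    MeasurableSet.iInter fun n => MeasurableSet.biUnion (Set.to_countable _) fun i _ => hAm i
  have hae : ∀ᵐ ω ∂P, ω ∈ ⋂ n, ⋃ i ∈ Set.Ici n, A i := (prob_compl_eq_zero_iff hmT).2 h1
  filter_upwards [hae] with ω hω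
  obtain ⟨i, -, hi⟩ := Set.mem_iUnion₂.1 (Set.mem_iInter.1 hω 0)
  exact ⟨i, hi⟩

end Chain

/-! ### Walks that follow prescribed draws -/

/-- A recurrent nearest neighbour walk, which jumps to the right exactly when the next draw at its
current position is Red, crosses every edge to the left. -/
lemma exists_backward_ne_zero {b : ℤ → ℕ → Bool} {pos : ℕ → ℤ} {loc : ℕ → ℤ → ℕ}
    (hpos0 : pos 0 = 0) (hloc0 : ∀ x, loc 0 x = 0)
    (hpos : ∀ n, pos (n + 1) = if b (pos n) (loc n (pos n)) = true then pos n + 1 else pos n - 1)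
    (hloc : ∀ n, loc (n + 1) = Function.update (loc n) (pos n) (loc n (pos n) + 1))
    (hinf : ∀ i : ℕ, InfinitelyRed (b (i + 1)))
    (hrec : ∀ x, ∃ᶠ n in atTop, pos n = x) (i : ℕ) :
    ∃ n, backward (fun k : ℕ => b (k + 1)) n i ≠ 0 := by
  -- Conservation across the edge between `x` and `x + 1`: crossings to the right exceed those to
  -- the left by one exactly when the walk, started at `0 ≤ x`, is now beyond `x`.
  have hflow : ∀ n (x : ℤ), 0 ≤ x → reds (b x) (loc n x) =
      (loc n (x + 1) - reds (b (x + 1)) (loc n (x + 1))) + if x < pos n then 1 else 0 := by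
    intro n x hx
    induction n with
    | zero => simp [hloc0, hpos0, reds_zero, not_lt.2 hx]
    | succ n ih =>
      have hle := reds_le (b (x + 1)) (loc n (x + 1))
      rw [hloc, hpos]
      by_cases h1 : x = pos n
      · subst h1
        rw [Function.update_self, Function.update_of_ne (by omega), reds_succ]
        simp only [lt_irrefl, if_false] at ih
        split_ifs <;> omega
      · by_cases h2 : x + 1 = pos n
        · rw [Function.update_of_ne h1, h2, Function.update_self, reds_succ]
          rw [h2] at ih hle
          split_ifs at ih ⊢ <;> omega
        · rw [Function.update_of_ne h1, Function.update_of_ne h2]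
          split_ifs at ih ⊢ <;> omega
  have hbound : ∀ n, pos n ≤ n ∧ ∀ x : ℤ, (n : ℤ) ≤ x → loc n x = 0 := by
    intro n
    induction n with
    | zero => simp [hpos0, hloc0]
    | succ n ih =>
      refine ⟨?_, fun x hx => ?_⟩
      · rw [hpos]; push_cast; split_ifs <;> omega
      · push_cast at hx
        rw [hloc, Function.update_of_ne (by omega)]
        exact ih.2 x (by omega)
  have hmono : ∀ x, Monotone fun n => loc n x := by
    intro x
    refine monotone_nat_of_le_succ fun n => ?_
    rw [hloc]
    by_cases h : x = pos n
    · subst h; simp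
    · simp [Function.update_of_ne h]
  obtain ⟨s, -, hs⟩ := (frequently_atTop.1 (hrec (i + 1))) 0
  obtain ⟨t, hst, ht⟩ := (frequently_atTop.1 (hrec i)) s
  -- Comparison down from a level not yet visited at time `t`, where the chain starts from `0`. The
  -- chain is indexed so that `k` stands for the site `k + 1`.
  have hcross : ∀ n k : ℕ, i ≤ k → t ≤ k + 1 + n →
      loc t (k + 1) - reds (b (k + 1)) (loc t (k + 1)) ≤
        backward (fun k : ℕ => b (k + 1)) n k := by
    intro n
    induction n with
    | zero =>
      intro k _ hk
      rw [(hbound t).2 _ (by omega)]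
      simp
    | succ n ih =>
      intro k hik hk
      have h1 := ih (k + 1) (by omega) (by omega)
      have h2 := hflow t (k + 1) (by omega)
      rw [if_neg (by omega)] at h2
      push_cast at h1
      exact le_failures (hinf k) (by omega)
  -- If the chain vanished, no jump from `i + 1` to `i`, hence none from `i` to `i + 1`, would have
  -- occurred by time `t`; but at the earlier time `s` the walk was at `i + 1`.
  refine ⟨t, fun h0 => ?_⟩
  have h1 := hcross t i le_rfl (by omega)
  have h2 := hflow t i (by omega)
  have h3 := hflow s i (by omega)
  rw [if_neg (by omega)] at h2
  rw [if_pos (by omega)] at h3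
  have h4 := reds_mono (b i) (hmono i hst)
  simp only at h4
  omega

/-! ### A single urn -/

/-- The law of the sequence of uniform variables that drives one urn. -/
noncomputable def drawMeasure : Measure (ℕ → unitInterval) :=
  Measure.infinitePi fun _ : ℕ => (volume : Measure unitInterval)

instance : IsProbabilityMeasure drawMeasure := by unfold drawMeasure; infer_instance

/-- The sequence of draws of an urn, `true` standing for Red. -/
noncomputable def draws (f : ℝ → ℝ) (s : UrnState) (u : ℕ → unitInterval) (k : ℕ) : Bool :=
  decide ((u k : ℝ) < f (urn f s u k).1)

/-- The admissible states of an urn. -/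
def IsUrnState (s : UrnState) : Prop := s.1 ∈ Set.Icc (0 : ℝ) 1 ∧ 0 < s.2

lemma IsUrnState.urnStep {s : UrnState} (hs : IsUrnState s) (f : ℝ → ℝ) (v : unitInterval) :
    IsUrnState (urnStep f v s) := by
  obtain ⟨⟨h0, h1⟩, hl⟩ := hs
  have hl1 : 0 < s.2 + 1 := by linarith
  have hmul : s.2 * s.1 ≤ s.2 := by nlinarith
  have hmul0 : 0 ≤ s.2 * s.1 := by positivity
  unfold RRW.urnStep
  split_ifs
  · exact ⟨⟨by positivity, by simp only; rw [div_le_one hl1]; linarith⟩, hl1⟩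
  · exact ⟨⟨by positivity, by simp only; rw [div_le_one hl1]; linarith⟩, hl1⟩

lemma IsUrnState.urn {s : UrnState} (hs : IsUrnState s) (f : ℝ → ℝ) (u : ℕ → unitInterval)
    (k : ℕ) : IsUrnState (urn f s u k) := by
  induction k with
  | zero => exact hs
  | succ k ih => exact ih.urnStep f (u k)

lemma urn_snd (f : ℝ → ℝ) (s : UrnState) (u : ℕ → unitInterval) (k : ℕ) :
    (urn f s u k).2 = s.2 + k := by
  induction k with
  | zero => simp [urn]
  | succ k ih =>
    have : (urn f s u (k + 1)).2 = (urn f s u k).2 + 1 := by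
      simp only [urn, urnStep]; split_ifs <;> rfl
    rw [this, ih]; push_cast; ring

lemma measurable_urnStep {f : ℝ → ℝ} (hf : Measurable f) :
    Measurable fun q : unitInterval × UrnState => urnStep f q.1 q.2 := by
  unfold urnStep
  refine Measurable.ite (measurableSet_lt (by fun_prop) (by fun_prop)) ?_ ?_ <;> fun_prop

lemma measurable_urn_history {f : ℝ → ℝ} (hf : Measurable f) (s : UrnState) (k : ℕ) :
    Measurable[⨆ i ∈ Set.Iio k, MeasurableSpace.comap (fun u : ℕ → unitInterval => u i)
      inferInstance] fun u => urn f s u k := by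
  induction k with
  | zero => exact @measurable_const _ _ _ _ _
  | succ k ih =>
    have h1 := ih.mono (biSup_mono fun i hi => by simp at hi ⊢; omega :
      _ ≤ ⨆ i ∈ Set.Iio (k + 1), MeasurableSpace.comap (fun u : ℕ → unitInterval => u i)
      inferInstance) le_rfl
    have h2 : Measurable[⨆ i ∈ Set.Iio (k + 1), MeasurableSpace.comap
        (fun u : ℕ → unitInterval => u i) inferInstance] fun u : ℕ → unitInterval => u k :=
      (comap_measurable _).mono
        (le_biSup (fun i => MeasurableSpace.comap (fun u : ℕ → unitInterval => u i) inferInstance)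
          (by simp)) le_rfl
    exact (measurable_urnStep hf).comp (h2.prodMk h1)

lemma history_le (k : ℕ) :
    (⨆ i ∈ Set.Iio k, MeasurableSpace.comap (fun u : ℕ → unitInterval => u i) inferInstance)
      ≤ MeasurableSpace.pi :=
  iSup₂_le fun i _ => (measurable_pi_apply i).comap_le

lemma measurable_urn {f : ℝ → ℝ} (hf : Measurable f) (s : UrnState) (k : ℕ) :
    Measurable fun u => urn f s u k :=
  (measurable_urn_history hf s k).mono (history_le k) le_rfl

lemma measurable_draws {f : ℝ → ℝ} (hf : Measurable f) (s : UrnState) :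
    Measurable (draws f s) := by
  refine measurable_pi_lambda _ fun k => ?_
  refine measurable_to_bool ?_
  have : (fun u => draws f s u k) ⁻¹' {true} = {u | (u k : ℝ) < f (urn f s u k).1} := by
    ext u; simp [draws]
  rw [this]
  have := measurable_urn hf s k
  exact measurableSet_lt (by fun_prop) (by fun_prop)

lemma measurable_reds_draws_history {f : ℝ → ℝ} (hf : Measurable f) (s : UrnState) (k : ℕ) :
    Measurable[⨆ i ∈ Set.Iio k, MeasurableSpace.comap (fun u : ℕ → unitInterval => u i)
      inferInstance] fun u => reds (draws f s u) k := by
  induction k with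
  | zero => simp only [reds_zero]; exact @measurable_const _ _ _ _ _
  | succ k ih =>
    have hle : (⨆ i ∈ Set.Iio k, MeasurableSpace.comap (fun u : ℕ → unitInterval => u i)
        inferInstance) ≤ ⨆ i ∈ Set.Iio (k + 1), MeasurableSpace.comap
        (fun u : ℕ → unitInterval => u i) inferInstance :=
      biSup_mono fun i hi => by simp at hi ⊢; omega
    have h1 := ih.mono hle le_rfl
    have h3 := (measurable_urn_history hf s k).mono hle le_rfl
    have h2 : Measurable[⨆ i ∈ Set.Iio (k + 1), MeasurableSpace.comap
        (fun u : ℕ → unitInterval => u i) inferInstance] fun u : ℕ → unitInterval => u k :=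
      (comap_measurable _).mono
        (le_biSup (fun i => MeasurableSpace.comap (fun u : ℕ → unitInterval => u i) inferInstance)
          (by simp)) le_rfl
    have hG : Measurable fun q : ℕ × UrnState × unitInterval =>
        q.1 + if (q.2.2 : ℝ) < f q.2.1.1 then 1 else 0 := by
      refine measurable_fst.add (Measurable.ite (measurableSet_lt ?_ ?_) measurable_const
        measurable_const) <;> fun_prop
    have h4 := hG.comp (h1.prodMk (h3.prodMk h2))
    have h5 : (fun u => reds (draws f s u) (k + 1)) = (fun q : ℕ × UrnState × unitInterval =>
        q.1 + if (q.2.2 : ℝ) < f q.2.1.1 then 1 else 0) ∘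
        fun u => (reds (draws f s u) k, urn f s u k, u k) := by
      funext u
      simp [reds_succ, draws]
    rw [h5]
    exact h4

/-- A function of the first `k` uniform variables is independent of the next one. -/
lemma lintegral_next {β : Type*} [MeasurableSpace β] {k : ℕ} {Y : (ℕ → unitInterval) → β}
    (hY : Measurable[⨆ i ∈ Set.Iio k, MeasurableSpace.comap (fun u : ℕ → unitInterval => u i)
      inferInstance] Y) {F : β × unitInterval → ℝ≥0∞} (hF : Measurable F) :
    ∫⁻ u, F (Y u, u k) ∂drawMeasure = ∫⁻ u, ∫⁻ v, F (Y u, v) ∂volume ∂drawMeasure := by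
  have hind : iIndepFun (fun (i : ℕ) (u : ℕ → unitInterval) => u i) drawMeasure :=
    iIndepFun_infinitePi (X := fun _ v => v) (fun _ => measurable_id)
  have h := indep_iSup_of_disjoint (fun i => (measurable_pi_apply i).comap_le) hind
    (S := Set.Iio k) (T := {k}) (by simp)
  have hYm : Measurable Y := hY.mono (history_le k) le_rfl
  have hIF : IndepFun Y (fun u : ℕ → unitInterval => u k) drawMeasure := by
    rw [IndepFun_iff_Indep]
    refine indep_of_indep_of_le_left (indep_of_indep_of_le_right h ?_) hY.comap_le
    exact le_biSup (fun i => MeasurableSpace.comap (fun u : ℕ → unitInterval => u i) inferInstance)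
      (Set.mem_singleton k)
  have hlaw : drawMeasure.map (fun u => u k) = volume := Measure.infinitePi_map_eval _ k
  have hprod := (indepFun_iff_map_prod_eq_prod_map_map hYm.aemeasurable
    (measurable_pi_apply k).aemeasurable).1 hIF
  rw [hlaw] at hprod
  have : IsProbabilityMeasure (drawMeasure.map Y) :=
    Measure.isProbabilityMeasure_map hYm.aemeasurable
  calc _ = ∫⁻ q, F q ∂(drawMeasure.map fun u => (Y u, u k)) := by
        rw [lintegral_map hF (hYm.prodMk (measurable_pi_apply k))]
    _ = ∫⁻ y, ∫⁻ v, F (y, v) ∂volume ∂(drawMeasure.map Y) := by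
        rw [hprod, lintegral_prod _ hF.aemeasurable]
    _ = _ := by rw [lintegral_map hF.lintegral_prod_right' hYm]

lemma volume_lt {c : ℝ} (hc : c ∈ Set.Icc (0 : ℝ) 1) :
    volume {v : unitInterval | (v : ℝ) < c} = ENNReal.ofReal c := by
  have h := unitInterval.volume_Iio (⟨c, hc⟩ : unitInterval)
  exact h

lemma volume_not_lt {c : ℝ} (hc : c ∈ Set.Icc (0 : ℝ) 1) :
    volume {v : unitInterval | ¬ (v : ℝ) < c} = ENNReal.ofReal (1 - c) := by
  have hm : MeasurableSet {v : unitInterval | (v : ℝ) < c} :=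
    measurableSet_lt (by fun_prop) (by fun_prop)
  have : {v : unitInterval | ¬ (v : ℝ) < c} = {v : unitInterval | (v : ℝ) < c}ᶜ := rfl
  rw [this, prob_compl_eq_one_sub hm, volume_lt hc, ENNReal.ofReal_sub _ hc.1, ENNReal.ofReal_one]

lemma lintegral_ite_lt {c : ℝ} (hc : c ∈ Set.Icc (0 : ℝ) 1) (A B : ℝ≥0∞) :
    ∫⁻ v : unitInterval, (if (v : ℝ) < c then A else B) =
      ENNReal.ofReal c * A + ENNReal.ofReal (1 - c) * B := by
  have hm : MeasurableSet {v : unitInterval | (v : ℝ) < c} :=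
    measurableSet_lt (by fun_prop) (by fun_prop)
  rw [← lintegral_add_compl _ hm, setLIntegral_congr_fun (g := fun _ => A) hm,
    setLIntegral_congr_fun (g := fun _ => B) hm.compl]
  · rw [setLIntegral_const, setLIntegral_const, volume_lt hc, mul_comm A, mul_comm B]
    congr 2
    exact volume_not_lt hc
  · intro v hv
    exact if_neg hv
  · intro v hv
    exact if_pos hv

/-- The urn and its number of Red draws before draw `k` are functions of the first `k` uniform
variables, and the next one falls below `f α` with probability `f α` independently of them. -/
lemma isCompensated_draws {f : ℝ → ℝ} (hf : Measurable f) {ε : ℝ} (hε : 0 < ε)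
    (hfε : ∀ t, ε ≤ f t) (hf1 : ∀ t, f t ≤ 1) (s : UrnState) :
    IsCompensated drawMeasure (draws f s) (fun k u => f (urn f s u k).1) ε where
  measurable_draw := measurable_draws hf s
  measurable_rate k := by have := measurable_urn hf s k; fun_prop
  pos := hε
  le_rate _ _ := hfε _
  rate_le _ _ := hf1 _
  red k T := by
    classical
    have hm : MeasurableSet {u | reds (draws f s u) k ∈ T} :=
      ((measurable_reds k).comp (measurable_draws hf s)) (MeasurableSet.of_discrete (s := T))
    have hm2 : MeasurableSet {u | reds (draws f s u) k ∈ T ∧ draws f s u k = true} :=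
      hm.inter (((measurable_pi_apply k).comp (measurable_draws hf s)) (measurableSet_singleton _))
    have hF : Measurable fun q : (ℕ × UrnState) × unitInterval =>
        if q.1.1 ∈ T then (if (q.2 : ℝ) < f q.1.2.1 then (1 : ℝ≥0∞) else 0) else 0 := by
      refine Measurable.ite ((measurable_fst.comp measurable_fst)
        (MeasurableSet.of_discrete (s := T))) (Measurable.ite (measurableSet_lt ?_ ?_) ?_ ?_) ?_
        <;> fun_prop
    have h := lintegral_next ((measurable_reds_draws_history hf s k).prodMk
      (measurable_urn_history hf s k)) hF
    rw [← lintegral_indicator_one hm2, ← lintegral_indicator hm]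
    refine Eq.trans (lintegral_congr fun u => ?_) (h.trans (lintegral_congr fun u => ?_))
    · by_cases h1 : reds (draws f s u) k ∈ T <;> simp [Set.indicator_apply, h1, draws]
    · by_cases h1 : reds (draws f s u) k ∈ T
      · simp only [h1, if_true]
        rw [lintegral_ite_lt ⟨hε.le.trans (hfε _), hf1 _⟩]
        simp [h1]
      · simp [h1]
  not_red k T := by
    classical
    have hm : MeasurableSet {u | reds (draws f s u) k ∈ T} :=
      ((measurable_reds k).comp (measurable_draws hf s)) (MeasurableSet.of_discrete (s := T))
    have hm2 : MeasurableSet {u | reds (draws f s u) k ∈ T ∧ draws f s u k = false} :=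
      hm.inter (((measurable_pi_apply k).comp (measurable_draws hf s)) (measurableSet_singleton _))
    have hF : Measurable fun q : (ℕ × UrnState) × unitInterval =>
        if q.1.1 ∈ T then (if (q.2 : ℝ) < f q.1.2.1 then (0 : ℝ≥0∞) else 1) else 0 := by
      refine Measurable.ite ((measurable_fst.comp measurable_fst)
        (MeasurableSet.of_discrete (s := T))) (Measurable.ite (measurableSet_lt ?_ ?_) ?_ ?_) ?_
        <;> fun_prop
    have h := lintegral_next ((measurable_reds_draws_history hf s k).prodMk
      (measurable_urn_history hf s k)) hF
    rw [← lintegral_indicator_one hm2, ← lintegral_indicator hm]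
    refine Eq.trans (lintegral_congr fun u => ?_) (h.trans (lintegral_congr fun u => ?_))
    · by_cases h1 : reds (draws f s u) k ∈ T
      · by_cases h2 : (u k : ℝ) < f (urn f s u k).1
        · simp [h1, h2, draws]
        · simp [h1, h2, draws, not_lt.1 h2]
      · simp [h1]
    · by_cases h1 : reds (draws f s u) k ∈ T
      · simp only [h1, if_true]
        rw [lintegral_ite_lt ⟨hε.le.trans (hfε _), hf1 _⟩]
        simp [h1]
      · simp [h1]

/-- Interchanging the two colours. -/
lemma reds_not (b : ℕ → Bool) (k : ℕ) : reds (fun i => !b i) k = k - reds b k := by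
  induction k with
  | zero => simp [reds_zero]
  | succ k ih =>
    have := reds_le b k
    rw [reds_succ, reds_succ, ih]
    cases b k <;> simp
    omega

/-- Used to treat the negative half-line. Events in the number of Red draws remain of this kind,
through `j ↦ k - j`. -/
lemma IsCompensated.flip {S : Type*} [MeasurableSpace S] {μ : Measure S} {r : S → ℕ → Bool}
    {φ : ℕ → S → ℝ} {ε ε' : ℝ} (h : IsCompensated μ r φ ε) (hε' : 0 < ε')
    (hφ : ∀ k s, φ k s ≤ 1 - ε') :
    IsCompensated μ (fun s k => !r s k) (fun k s => 1 - φ k s) ε' where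
  measurable_draw := measurable_pi_lambda _ fun k =>
    (measurable_of_countable not).comp ((measurable_pi_apply k).comp h.measurable_draw)
  measurable_rate k := measurable_const.sub (h.measurable_rate k)
  pos := hε'
  le_rate k s := by linarith [hφ k s]
  rate_le k s := by linarith [h.le_rate k s, h.pos]
  red k T := by
    have := h.not_red k {j | k - j ∈ T}
    simp only [Set.mem_ofPred_eq] at this
    simpa only [reds_not, Bool.not_eq_true'] using this
  not_red k T := by
    have := h.red k {j | k - j ∈ T}
    simp only [Set.mem_ofPred_eq] at this
    simpa only [reds_not, Bool.not_eq_false', sub_sub_cancel] using this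

/-! ### Potential functions of an urn -/

/-- The state after a Red draw. -/
noncomputable def redState (s : UrnState) : UrnState := ((s.2 * s.1 + 1) / (s.2 + 1), s.2 + 1)

/-- The state after a draw of the other colour. -/
noncomputable def blackState (s : UrnState) : UrnState := (s.2 * s.1 / (s.2 + 1), s.2 + 1)

lemma urnStep_eq (f : ℝ → ℝ) (v : unitInterval) (s : UrnState) :
    urnStep f v s = if (v : ℝ) < f s.1 then redState s else blackState s := rfl

lemma tsum_ne_top_of_telescope {a d e : ℕ → ℝ≥0∞} (h : ∀ k, a (k + 1) + d k ≤ a k + e k)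
    (ha : a 0 ≠ ⊤) (he : ∑' k, e k ≠ ⊤) : ∑' k, d k ≠ ⊤ := by
  have key : ∀ n, a n + ∑ k ∈ Finset.range n, d k ≤ a 0 + ∑ k ∈ Finset.range n, e k := by
    intro n
    induction n with
    | zero => simp
    | succ n ih =>
      rw [Finset.sum_range_succ, Finset.sum_range_succ]
      calc _ = (a (n + 1) + d n) + ∑ k ∈ Finset.range n, d k := by ring
        _ ≤ (a n + e n) + ∑ k ∈ Finset.range n, d k := add_le_add_left (h n) _
        _ = (a n + ∑ k ∈ Finset.range n, d k) + e n := by ring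
        _ ≤ (a 0 + ∑ k ∈ Finset.range n, e k) + e n := add_le_add_left ih _
        _ = _ := by ring
  refine ne_top_of_le_ne_top (ENNReal.add_ne_top.2 ⟨ha, he⟩)
    (ENNReal.tsum_le_of_sum_range_le fun n => ?_)
  exact le_add_self.trans ((key n).trans (add_le_add_right (ENNReal.sum_le_tsum _) _))

/-- The mean of the sum of `g` along the urn process. -/
noncomputable def meanSum (f : ℝ → ℝ) (s : UrnState) (g : UrnState → ℝ) : ℝ≥0∞ :=
  ∑' k, ∫⁻ u, ENNReal.ofReal (g (urn f s u k)) ∂drawMeasure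

/-- If the potential `V` decreases in mean by `d` up to an error `e`, then `d` is summable in mean
along the urn process as soon as `e` is. -/
lemma meanSum_ne_top_of_potential {f : ℝ → ℝ} (hf : Measurable f) (hf01 : ∀ t, f t ∈ Set.Icc (0 : ℝ) 1)
    {s : UrnState} (hs : IsUrnState s) {V d e : UrnState → ℝ} (hV : Measurable V)
    (hV0 : ∀ q, IsUrnState q → 0 ≤ V q) (hd0 : ∀ q, IsUrnState q → 0 ≤ d q)
    (he0 : ∀ q, IsUrnState q → 0 ≤ e q)
    (h : ∀ q, IsUrnState q →
      f q.1 * V (redState q) + (1 - f q.1) * V (blackState q) + d q ≤ V q + e q)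
    (hsum : meanSum f s e ≠ ⊤) : meanSum f s d ≠ ⊤ := by
  refine tsum_ne_top_of_telescope (a := fun k => ∫⁻ u, ENNReal.ofReal (V (urn f s u k)) ∂drawMeasure)
    (fun k => ?_) (by simp [urn]) hsum
  have hF : Measurable fun q : UrnState × unitInterval =>
      ENNReal.ofReal (V (urnStep f q.2 q.1)) :=
    (hV.comp ((measurable_urnStep hf).comp measurable_swap)).ennreal_ofReal
  have h1 := lintegral_next (measurable_urn_history hf s k) hF
  have hmu := measurable_urn hf s k
  have h2 : ∫⁻ u, ENNReal.ofReal (V (urn f s u (k + 1))) ∂drawMeasure =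
      ∫⁻ u, (ENNReal.ofReal (f (urn f s u k).1) * ENNReal.ofReal (V (redState (urn f s u k))) +
        ENNReal.ofReal (1 - f (urn f s u k).1) * ENNReal.ofReal (V (blackState (urn f s u k))))
        ∂drawMeasure := by
    refine h1.trans (lintegral_congr fun u => ?_)
    rw [← lintegral_ite_lt (hf01 _)]
    refine lintegral_congr fun v => ?_
    simp only [urnStep_eq]
    split_ifs <;> rfl
  have hmr : Measurable redState := by unfold redState; fun_prop
  have hmb : Measurable blackState := by unfold blackState; fun_prop
  rw [h2, ← lintegral_add_left (by fun_prop), ← lintegral_add_left (by fun_prop)]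
  refine lintegral_mono fun u => ?_
  have hq := hs.urn f u k
  set q := urn f s u k
  have hr : IsUrnState (redState q) := by
    -- A constant urn function that forces the colour reduces admissibility of the new state to that
    -- of a step.
    have := hq.urnStep (fun _ => 2) 0
    rwa [urnStep_eq, if_pos (by norm_num)] at this
  have hb : IsUrnState (blackState q) := by
    have := hq.urnStep (fun _ => 0) 0
    rwa [urnStep_eq, if_neg (by norm_num)] at this
  have hp := hf01 q.1
  rw [← ENNReal.ofReal_mul hp.1, ← ENNReal.ofReal_mul (by linarith [hp.2]),
    ← ENNReal.ofReal_add (mul_nonneg hp.1 (hV0 _ hr))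
      (mul_nonneg (by linarith [hp.2]) (hV0 _ hb)),
    ← ENNReal.ofReal_add (add_nonneg (mul_nonneg hp.1 (hV0 _ hr))
      (mul_nonneg (by linarith [hp.2]) (hV0 _ hb))) (hd0 q hq),
    ← ENNReal.ofReal_add (hV0 q hq) (he0 q hq)]
  exact ENNReal.ofReal_le_ofReal (h q hq)

/-! ### Convergence of the proportion of Red balls -/

/-- Taylor's formula by induction on the exponent, multiplying by `x + h ≥ 0`. The remainder keeps
`x ^ m` with `h ^ 2`, which the later potential estimates need; the rest is cubic. -/
lemma exists_pow_add_le (m : ℕ) : ∃ C : ℝ, 0 ≤ C ∧ ∀ x h : ℝ, 0 ≤ x → x ≤ 1 → 0 ≤ x + h →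
    |h| ≤ 1 → (x + h) ^ (m + 2) ≤
      x ^ (m + 2) + (m + 2) * x ^ (m + 1) * h + C * (x ^ m * h ^ 2 + |h| ^ 3) := by
  induction m with
  | zero =>
    refine ⟨1, zero_le_one, fun x h hx _ _ _ => ?_⟩
    have : 0 ≤ |h| ^ 3 := by positivity
    push_cast
    nlinarith
  | succ m ih =>
    obtain ⟨C, hC, H⟩ := ih
    refine ⟨m + 2 + 3 * C, by positivity, fun x h hx hx1 hxh hh => ?_⟩
    have h1 := mul_le_mul_of_nonneg_right (H x h hx hx1 hxh hh) hxh
    have h2 : x ^ m * h ^ 2 * h ≤ |h| ^ 3 := by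
      have ha : x ^ m * h ^ 2 * h ≤ x ^ m * |h| ^ 3 := by
        rw [mul_assoc]
        refine mul_le_mul_of_nonneg_left ?_ (by positivity)
        calc h ^ 2 * h = |h| ^ 2 * h := by rw [sq_abs]
          _ ≤ |h| ^ 2 * |h| := mul_le_mul_of_nonneg_left (le_abs_self h) (by positivity)
          _ = |h| ^ 3 := by ring
      have hb : x ^ m * |h| ^ 3 ≤ 1 * |h| ^ 3 :=
        mul_le_mul_of_nonneg_right (pow_le_one₀ hx hx1) (by positivity)
      linarith
    have h3 : |h| ^ 3 * (x + h) ≤ 2 * |h| ^ 3 := by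
      have : x + h ≤ 2 := by linarith [le_abs_self h]
      nlinarith [show 0 ≤ |h| ^ 3 by positivity]
    have h4 : 0 ≤ x ^ (m + 1) * h ^ 2 := by positivity
    have h5 : 0 ≤ |h| ^ 3 := by positivity
    have e1 : (x + h) ^ (m + 1 + 2) = (x + h) ^ (m + 2) * (x + h) := by ring
    have e2 : (x ^ (m + 2) + (m + 2) * x ^ (m + 1) * h + C * (x ^ m * h ^ 2 + |h| ^ 3)) * (x + h)
        = x ^ (m + 1 + 2) + (m + 3) * x ^ (m + 1 + 1) * h + (m + 2) * (x ^ (m + 1) * h ^ 2)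
          + C * (x ^ (m + 1) * h ^ 2 + x ^ m * h ^ 2 * h + |h| ^ 3 * (x + h)) := by ring
    rw [e1]
    refine h1.trans ?_
    rw [e2]
    push_cast
    have h6 : C * (x ^ (m + 1) * h ^ 2 + x ^ m * h ^ 2 * h + |h| ^ 3 * (x + h)) ≤
        C * (x ^ (m + 1) * h ^ 2 + 3 * |h| ^ 3) :=
      mul_le_mul_of_nonneg_left (by linarith) hC
    have h7 : 0 ≤ (m : ℝ) := by positivity
    have h8 : 0 ≤ C * (x ^ (m + 1) * h ^ 2) := by positivity
    have h9 : 0 ≤ (m + 2 : ℝ) * |h| ^ 3 := by positivity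
    have e3 : (m : ℝ) + 1 + 2 = m + 3 := by ring
    rw [e3]
    linarith [h6, h8, h9]

/-- Second order expansion of the `(m + 2)`-nd power of the positive part. -/
lemma exists_posPart_pow_le (m : ℕ) : ∃ C : ℝ, 0 ≤ C ∧ ∀ x h : ℝ, x ≤ 1 → |h| ≤ 1 →
    (max (x + h) 0) ^ (m + 2) ≤ (max x 0) ^ (m + 2) + (m + 2) * (max x 0) ^ (m + 1) * h
      + C * ((max x 0) ^ m * h ^ 2 + |h| ^ 3) := by
  obtain ⟨C, hC, H⟩ := exists_pow_add_le m
  refine ⟨C + m + 2, by positivity, fun x h hx hh => ?_⟩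
  have h0 : 0 ≤ |h| ^ 3 := by positivity
  have hm : (0 : ℝ) ≤ m := by positivity
  rcases le_or_gt x 0 with hx0 | hx0
  · rw [max_eq_right hx0]
    have h1 : max (x + h) 0 ≤ |h| := max_le (by linarith [le_abs_self h]) (abs_nonneg h)
    have h2 : (max (x + h) 0) ^ (m + 2) ≤ |h| ^ (m + 2) :=
      pow_le_pow_left₀ (le_max_right _ _) h1 _
    have h3 : |h| ^ (m + 2) ≤ (0 : ℝ) ^ m * h ^ 2 + |h| ^ 3 := by
      cases m with
      | zero => simp [h0]
      | succ m =>
        have : |h| ^ (m + 1 + 2) ≤ |h| ^ 3 :=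
          pow_le_pow_of_le_one (abs_nonneg h) hh (by omega)
        simpa using this
    have h4 : (0 : ℝ) ^ m * h ^ 2 + |h| ^ 3 ≤ (C + m + 2) * ((0 : ℝ) ^ m * h ^ 2 + |h| ^ 3) :=
      le_mul_of_one_le_left (by positivity) (by linarith)
    simp only [ne_eq, Nat.add_eq_zero_iff, OfNat.ofNat_ne_zero, and_false, not_false_eq_true,
      zero_pow, one_ne_zero, mul_zero, zero_mul, zero_add]
    linarith
  · rw [max_eq_left hx0.le]
    rcases le_or_gt 0 (x + h) with hxh | hxh
    · rw [max_eq_left hxh]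
      have h1 := H x h hx0.le hx hxh hh
      have h2 : 0 ≤ (m + 2) * (x ^ m * h ^ 2 + |h| ^ 3) := by positivity
      nlinarith
    · rw [max_eq_right hxh.le]
      -- The step crosses `0`, so `x < -h`, and the negative first-order term is absorbed by the
      -- second-order one.
      have h1 : x ^ (m + 1) * (-h) ≤ x ^ m * h ^ 2 := by
        have : x ^ (m + 1) * (-h) = x ^ m * (x * (-h)) := by ring
        rw [this]
        exact mul_le_mul_of_nonneg_left (by nlinarith) (by positivity)
      have h2 : 0 ≤ x ^ (m + 2) := by positivity
      have h3 : 0 ≤ C * (x ^ m * h ^ 2 + |h| ^ 3) := by positivity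
      have h4 : 0 ≤ (m + 2) * |h| ^ 3 := by positivity
      have h5 : (m + 2) * (x ^ (m + 1) * (-h)) ≤ (m + 2) * (x ^ m * h ^ 2) :=
        mul_le_mul_of_nonneg_left h1 (by positivity)
      have h6 : (0 : ℝ) ^ (m + 2) = 0 := by simp
      nlinarith

/-- The excess of the proportion over `b`, in the direction `σ`. -/
def excess (σ b : ℝ) (q : UrnState) : ℝ := max (σ * (q.1 - b)) 0

lemma excess_nonneg (σ b : ℝ) (q : UrnState) : 0 ≤ excess σ b q := le_max_right _ _

lemma measurable_excess (σ b : ℝ) : Measurable (excess σ b) := by unfold excess; fun_prop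

/-- Mean evolution of powers of the excess, under a drift towards `b`. -/
lemma exists_excess_step (m : ℕ) : ∃ C : ℝ, 0 ≤ C ∧ ∀ (f : ℝ → ℝ) (σ b c β : ℝ) (q : UrnState),
    f q.1 ∈ Set.Icc (0 : ℝ) 1 → |σ| = 1 → IsUrnState q → σ * (q.1 - b) ≤ 1 → 0 ≤ β →
    excess σ b q * (σ * (f q.1 - q.1)) ≤ -(c * excess σ b q ^ 2) + β →
    f q.1 * excess σ b (redState q) ^ (m + 2) + (1 - f q.1) * excess σ b (blackState q) ^ (m + 2) ≤
      excess σ b q ^ (m + 2) - (m + 2) * c * excess σ b q ^ (m + 2) / (q.2 + 1)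
        + (m + 2) * β / (q.2 + 1)
        + C * (excess σ b q ^ m / (q.2 + 1) ^ 2 + 1 / (q.2 + 1) ^ 3) := by
  obtain ⟨C, hC, H⟩ := exists_posPart_pow_le m
  refine ⟨C, hC, fun f σ b c β q hp hσ hq hx hβ hdrift => ?_⟩
  obtain ⟨⟨hα0, hα1⟩, hl⟩ := hq
  set L := q.2 + 1 with hL
  have hLpos : 0 < L := by linarith
  have hL1 : 1 ≤ L := by linarith
  set p := f q.1
  set y := excess σ b q with hy
  have hy0 : 0 ≤ y := excess_nonneg _ _ _
  have hy1 : y ≤ 1 := max_le hx zero_le_one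
  set x := σ * (q.1 - b) with hxdef
  have hr : excess σ b (redState q) = max (x + σ * (1 - q.1) / L) 0 := by
    unfold excess redState
    congr 1
    simp only
    field_simp
    rw [hxdef, hL]; ring
  have hb : excess σ b (blackState q) = max (x + -(σ * q.1) / L) 0 := by
    unfold excess blackState
    congr 1
    simp only
    field_simp
    rw [hxdef, hL]; ring
  have bound : ∀ z : ℝ, |z| ≤ 1 → |z / L| ≤ 1 ∧ (z / L) ^ 2 ≤ 1 / L ^ 2 ∧ |z / L| ^ 3 ≤ 1 / L ^ 3 := by
    intro z hz
    have h1 : |z / L| ≤ 1 / L := by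
      rw [abs_div, abs_of_pos hLpos]
      gcongr
    refine ⟨h1.trans (by rw [div_le_one hLpos]; exact hL1), ?_, ?_⟩
    · rw [← sq_abs, ← one_div_pow]; gcongr
    · rw [← one_div_pow]; gcongr
  obtain ⟨a1, a2, a3⟩ := bound (σ * (1 - q.1))
    (by rw [abs_mul, hσ, one_mul, abs_of_nonneg (by linarith)]; linarith)
  obtain ⟨b1, b2, b3⟩ := bound (-(σ * q.1))
    (by rw [abs_neg, abs_mul, hσ, one_mul, abs_of_nonneg hα0]; exact hα1)
  have step : ∀ h : ℝ, |h| ≤ 1 → h ^ 2 ≤ 1 / L ^ 2 → |h| ^ 3 ≤ 1 / L ^ 3 →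
      (max (x + h) 0) ^ (m + 2) ≤ y ^ (m + 2) + (m + 2) * y ^ (m + 1) * h
        + C * (y ^ m / L ^ 2 + 1 / L ^ 3) := by
    intro h c1 c2 c3
    refine (H x h hx c1).trans ?_
    have hyx : max x 0 = y := rfl
    rw [hyx]
    have : y ^ m * h ^ 2 ≤ y ^ m / L ^ 2 := by
      rw [div_eq_mul_one_div]
      exact mul_le_mul_of_nonneg_left c2 (by positivity)
    gcongr
  have s1 := mul_le_mul_of_nonneg_left (step _ a1 a2 a3) hp.1
  have s2 := mul_le_mul_of_nonneg_left (step _ b1 b2 b3) (by linarith [hp.2] : 0 ≤ 1 - p)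
  rw [hr, hb]
  refine (add_le_add s1 s2).trans ?_
  -- The mean displacement is `p (1 - α) - (1 - p) α = p - α`, divided by `L`.
  have e : p * (y ^ (m + 2) + (m + 2) * y ^ (m + 1) * (σ * (1 - q.1) / L)
        + C * (y ^ m / L ^ 2 + 1 / L ^ 3)) +
      (1 - p) * (y ^ (m + 2) + (m + 2) * y ^ (m + 1) * (-(σ * q.1) / L)
        + C * (y ^ m / L ^ 2 + 1 / L ^ 3)) =
      y ^ (m + 2) + (m + 2) * (y ^ m * (y * (σ * (p - q.1)))) / L
        + C * (y ^ m / L ^ 2 + 1 / L ^ 3) := by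
    field_simp
    ring
  rw [e]
  have h1 : y ^ m * (y * (σ * (p - q.1))) ≤ -(c * y ^ (m + 2)) + β := by
    calc _ ≤ y ^ m * (-(c * y ^ 2) + β) := mul_le_mul_of_nonneg_left hdrift (by positivity)
      _ = -(c * y ^ (m + 2)) + y ^ m * β := by ring
      _ ≤ -(c * y ^ (m + 2)) + 1 * β := by gcongr; exact pow_le_one₀ hy0 hy1
      _ = _ := by rw [one_mul]
  have h2 : (m + 2) * (y ^ m * (y * (σ * (p - q.1)))) / L ≤
      (m + 2) * (-(c * y ^ (m + 2)) + β) / L := by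
    gcongr
  have h3 : (m + 2) * (-(c * y ^ (m + 2)) + β) / L =
      -((m + 2) * c * y ^ (m + 2) / L) + (m + 2) * β / L := by ring
  linarith

/-! ### Summability of powers of the excess along the urn process. -/

section MeanSum

variable {f : ℝ → ℝ} {s : UrnState}

lemma meanSum_ne_top_of_le (hf : Measurable f) (hs : IsUrnState s) {g g₁ g₂ g₃ : UrnState → ℝ}
    {a : ℝ} (ha : 0 ≤ a)
    (hm₁ : Measurable g₁) (hm₂ : Measurable g₂)
    (h : ∀ q, IsUrnState q → g q ≤ a * (g₁ q + g₂ q + g₃ q))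
    (h₁ : meanSum f s g₁ ≠ ⊤) (h₂ : meanSum f s g₂ ≠ ⊤) (h₃ : meanSum f s g₃ ≠ ⊤) :
    meanSum f s g ≠ ⊤ := by
  have hle : meanSum f s g ≤
      ENNReal.ofReal a * (meanSum f s g₁ + meanSum f s g₂ + meanSum f s g₃) := by
    unfold meanSum
    rw [← ENNReal.tsum_add, ← ENNReal.tsum_add, ← ENNReal.tsum_mul_left]
    refine ENNReal.tsum_le_tsum fun k => ?_
    have hu := measurable_urn hf s k
    rw [← lintegral_add_left (by fun_prop), ← lintegral_add_left (by fun_prop),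
      ← lintegral_const_mul' _ _ ENNReal.ofReal_ne_top]
    refine lintegral_mono fun u => ?_
    refine (ENNReal.ofReal_le_ofReal (h _ (hs.urn f u k))).trans ?_
    rw [ENNReal.ofReal_mul ha]
    gcongr
    exact ENNReal.ofReal_add_le.trans (add_le_add_left ENNReal.ofReal_add_le _)
  refine ne_top_of_le_ne_top (ENNReal.mul_ne_top ENNReal.ofReal_ne_top ?_) hle
  simp [h₁, h₂, h₃]

lemma meanSum_zero : meanSum f s (fun _ => 0) ≠ ⊤ := by simp [meanSum]

lemma meanSum_ne_top_of_summable (hs : IsUrnState s) {g : UrnState → ℝ} {a : ℕ → ℝ}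
    (ha : Summable a) (h : ∀ (k : ℕ) (q : UrnState), IsUrnState q → (k : ℝ) ≤ q.2 → g q ≤ a k) :
    meanSum f s g ≠ ⊤ := by
  refine ne_top_of_le_ne_top ha.tsum_ofReal_ne_top (ENNReal.tsum_le_tsum fun k => ?_)
  calc _ ≤ ∫⁻ _, ENNReal.ofReal (a k) ∂drawMeasure := by
        refine lintegral_mono fun u => ENNReal.ofReal_le_ofReal (h k _ (hs.urn f u k) ?_)
        rw [urn_snd]
        linarith [hs.2]
    _ = _ := by simp

lemma meanSum_inv_sq (hs : IsUrnState s) : meanSum f s (fun q => 1 / (q.2 + 1) ^ 2) ≠ ⊤ := by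
  refine meanSum_ne_top_of_summable hs
    ((summable_nat_add_iff 1).2 (Real.summable_one_div_nat_pow.2 one_lt_two)) fun k q _ hk => ?_
  push_cast
  gcongr

lemma meanSum_inv_mul_sqrt (hs : IsUrnState s) :
    meanSum f s (fun q => 1 / ((q.2 + 1) * √(q.2 + 1))) ≠ ⊤ := by
  refine meanSum_ne_top_of_summable hs ((summable_nat_add_iff 1).2
    (Real.summable_one_div_nat_rpow.2 (by norm_num : (1 : ℝ) < 1 + 1 / 2))) fun k q _ hk => ?_
  have hpos : (0 : ℝ) < (k + 1 : ℕ) := by positivity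
  rw [Real.rpow_add hpos, Real.rpow_one, ← Real.sqrt_eq_rpow]
  push_cast at hpos ⊢
  have := hpos.le.trans (add_le_add_left hk 1)
  gcongr

/-- The drift condition: a drift towards `b` in the direction `σ` of strength `c`, up to `B`. -/
structure HasDrift (f : ℝ → ℝ) (σ b c : ℝ) (B : UrnState → ℝ) : Prop where
  abs_eq : |σ| = 1
  le_one : ∀ q, IsUrnState q → σ * (q.1 - b) ≤ 1
  nonneg : ∀ q, IsUrnState q → 0 ≤ B q
  drift : ∀ q, IsUrnState q →
    excess σ b q * (σ * (f q.1 - q.1)) ≤ -(c * excess σ b q ^ 2) + B q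

variable {σ b c : ℝ} {B : UrnState → ℝ}

/-- Potential `y ^ 2` for the excess `y`, with error of order `1 / l ^ 2`. Any `c > 0` suffices,
which starts the bootstrap to higher powers. -/
lemma HasDrift.meanSum_sq_div (hf : Measurable f) (hf01 : ∀ t, f t ∈ Set.Icc (0 : ℝ) 1)
    (hs : IsUrnState s) (hc : 0 < c) (h : HasDrift f σ b c fun _ => 0) :
    meanSum f s (fun q => excess σ b q ^ 2 / (q.2 + 1)) ≠ ⊤ := by
  obtain ⟨C, hC, H⟩ := exists_excess_step 0
  have hme := measurable_excess σ b
  have key := meanSum_ne_top_of_potential hf hf01 hs (V := fun q => excess σ b q ^ 2)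
    (d := fun q => 2 * c * (excess σ b q ^ 2 / (q.2 + 1))) (e := fun q => 2 * C * (1 / (q.2 + 1) ^ 2))
    (by fun_prop) (fun q _ => by positivity)
    (fun q hq => by have := hq.2; positivity) (fun q hq => by positivity)
    (fun q hq => ?_) ?_
  · refine meanSum_ne_top_of_le hf hs (a := 1 / (2 * c)) (by positivity)
      (g₂ := fun _ => 0) (g₃ := fun _ => 0) (by fun_prop) measurable_const (fun q _ => ?_)
      key meanSum_zero meanSum_zero
    apply le_of_eq
    field_simp
    ring
  · have h1 := H f σ b c 0 q (hf01 _) h.abs_eq hq (h.le_one q hq) le_rfl (h.drift q hq)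
    have hL : 1 ≤ q.2 + 1 := by linarith [hq.2]
    have h2 : 1 / (q.2 + 1) ^ 3 ≤ 1 / (q.2 + 1) ^ 2 :=
      one_div_le_one_div_of_le (by positivity) (pow_le_pow_right₀ hL (by norm_num))
    have h3 : C * (1 / (q.2 + 1) ^ 3) ≤ C * (1 / (q.2 + 1) ^ 2) := mul_le_mul_of_nonneg_left h2 hC
    simp only [Nat.cast_zero, zero_add, pow_zero, mul_zero, zero_div, add_zero] at h1
    have e : 2 * c * (excess σ b q ^ 2 / (q.2 + 1)) = 2 * c * excess σ b q ^ 2 / (q.2 + 1) := by ring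
    rw [e]
    linarith
  · exact meanSum_ne_top_of_le hf hs (a := 2 * C) (by positivity) (g₂ := fun _ => 0)
      (g₃ := fun _ => 0) (by fun_prop) measurable_const (fun q _ => by simp)
      (meanSum_inv_sq hs) meanSum_zero meanSum_zero

/-- Potential `√l * y ^ 2`: the drift gains `2 c y ^ 2 / √(l + 1)`, while the growth of `√l` costs
at most `y ^ 2 / √(l + 1)`. -/
lemma HasDrift.meanSum_sq_div_sqrt (hf : Measurable f) (hf01 : ∀ t, f t ∈ Set.Icc (0 : ℝ) 1)
    (hs : IsUrnState s) (hc : 1 < 2 * c) (hB : Measurable B) (h : HasDrift f σ b c B)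
    (hBsum : meanSum f s B ≠ ⊤) :
    meanSum f s (fun q => excess σ b q ^ 2 / √(q.2 + 1)) ≠ ⊤ := by
  obtain ⟨C, hC, H⟩ := exists_excess_step 0
  have hme := measurable_excess σ b
  have hc' : 0 < 2 * c - 1 := by linarith
  have key := meanSum_ne_top_of_potential hf hf01 hs (V := fun q => √q.2 * excess σ b q ^ 2)
    (d := fun q => (2 * c - 1) * (excess σ b q ^ 2 / √(q.2 + 1)))
    (e := fun q => (2 * C + 2) * (B q + 1 / ((q.2 + 1) * √(q.2 + 1))))
    (by fun_prop) (fun q _ => by positivity)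
    (fun q hq => by positivity)
    (fun q hq => by have := hq.2; have := h.nonneg q hq; positivity)
    (fun q hq => ?_) ?_
  · refine meanSum_ne_top_of_le hf hs (a := 1 / (2 * c - 1)) (by positivity)
      (g₂ := fun _ => 0) (g₃ := fun _ => 0) (by fun_prop) measurable_const (fun q _ => ?_)
      key meanSum_zero meanSum_zero
    apply le_of_eq
    field_simp
    ring
  · have h1 := H f σ b c (B q) q (hf01 _) h.abs_eq hq (h.le_one q hq) (h.nonneg q hq) (h.drift q hq)
    have hl := hq.2
    have hBq := h.nonneg q hq
    have hr2 : (redState q).2 = q.2 + 1 := rfl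
    have hb2 : (blackState q).2 = q.2 + 1 := rfl
    rw [hr2, hb2]
    set L := q.2 + 1 with hL
    have hL1 : 1 ≤ L := by linarith
    have hlq : q.2 = L - 1 := by linarith
    set y := excess σ b q
    set w := √L with hw
    have hw1 : 1 ≤ w := Real.one_le_sqrt.2 hL1
    have hw2 : L = w ^ 2 := (Real.sq_sqrt (by linarith)).symm
    have hsq : w - 1 / w ≤ √q.2 := by
      refine Real.le_sqrt_of_sq_le ?_
      have : (w - 1 / w) ^ 2 = w ^ 2 - 2 + 1 / w ^ 2 := by field_simp; ring
      have h3 : 1 / w ^ 2 ≤ 1 := by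
        rw [div_le_one (by positivity)]; nlinarith
      rw [this, hlq, hw2]
      linarith
    have h2 := mul_le_mul_of_nonneg_left h1 (by positivity : 0 ≤ w)
    simp only [Nat.cast_zero, zero_add, pow_zero] at h2
    have e1 : w * (y ^ 2 - 2 * c * y ^ 2 / L + 2 * B q / L + C * (1 / L ^ 2 + 1 / L ^ 3)) =
        w * y ^ 2 - 2 * c * (y ^ 2 / w) + 2 * B q / w + C * (1 / w ^ 3 + 1 / w ^ 5) := by
      rw [hw2]; field_simp
    have h4 : (w - 1 / w) * y ^ 2 ≤ √q.2 * y ^ 2 := by gcongr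
    have e2 : (w - 1 / w) * y ^ 2 = w * y ^ 2 - y ^ 2 / w := by ring
    have h5 : 2 * B q / w ≤ 2 * B q := div_le_self (by positivity) hw1
    have h6 : C * (1 / w ^ 3 + 1 / w ^ 5) ≤ C * (2 * (1 / (L * w))) := by
      have : 1 / w ^ 5 ≤ 1 / w ^ 3 :=
        one_div_le_one_div_of_le (by positivity) (pow_le_pow_right₀ hw1 (by norm_num))
      have e : 1 / (L * w) = 1 / w ^ 3 := by rw [hw2]; ring
      rw [e]
      gcongr
      linarith
    have h7 : 0 ≤ 1 / (L * w) := by positivity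
    have h8 : 0 ≤ C * B q := by positivity
    rw [e1] at h2
    nlinarith
  · exact meanSum_ne_top_of_le hf hs (a := 2 * C + 2) (by positivity) (g₃ := fun _ => 0)
      hB (by fun_prop) (fun q _ => by simp) hBsum (meanSum_inv_mul_sqrt hs) meanSum_zero

/-- Potential `l * y ^ (m + 2)`: the growth of `l` costs `y ^ (m + 2)` per step, which the drift
outweighs when `(m + 2) c > 1`. -/
lemma HasDrift.meanSum_pow (hf : Measurable f) (hf01 : ∀ t, f t ∈ Set.Icc (0 : ℝ) 1)
    (hs : IsUrnState s) (m : ℕ) (hc : 1 < (m + 2) * c) (hB : Measurable B)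
    (h : HasDrift f σ b c B) (hBsum : meanSum f s B ≠ ⊤)
    (hsum : meanSum f s (fun q => excess σ b q ^ m / (q.2 + 1)) ≠ ⊤) :
    meanSum f s (fun q => excess σ b q ^ (m + 2)) ≠ ⊤ := by
  obtain ⟨C, hC, H⟩ := exists_excess_step m
  have hme := measurable_excess σ b
  have hc' : 0 < (m + 2) * c - 1 := by linarith
  have key := meanSum_ne_top_of_potential hf hf01 hs (V := fun q => q.2 * excess σ b q ^ (m + 2))
    (d := fun q => ((m + 2) * c - 1) * excess σ b q ^ (m + 2))
    (e := fun q => (C + m + 2) * (B q + excess σ b q ^ m / (q.2 + 1) + 1 / (q.2 + 1) ^ 2))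
    (by fun_prop)
    (fun q hq => mul_nonneg hq.2.le (pow_nonneg (excess_nonneg _ _ _) _))
    (fun q hq => mul_nonneg hc'.le (pow_nonneg (excess_nonneg _ _ _) _))
    (fun q hq => by
      have := hq.2; have := h.nonneg q hq; have := excess_nonneg σ b q; positivity)
    (fun q hq => ?_) ?_
  · refine meanSum_ne_top_of_le hf hs (a := 1 / ((m + 2) * c - 1)) (by positivity)
      (g₂ := fun _ => 0) (g₃ := fun _ => 0) (by fun_prop) measurable_const (fun q _ => ?_)
      key meanSum_zero meanSum_zero
    apply le_of_eq
    field_simp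
    ring
  · have h1 := H f σ b c (B q) q (hf01 _) h.abs_eq hq (h.le_one q hq) (h.nonneg q hq) (h.drift q hq)
    have hl := hq.2
    have hBq := h.nonneg q hq
    have hy := excess_nonneg σ b q
    have hr2 : (redState q).2 = q.2 + 1 := rfl
    have hb2 : (blackState q).2 = q.2 + 1 := rfl
    rw [hr2, hb2]
    set L := q.2 + 1 with hL
    have hLpos : 0 < L := by linarith
    have hlq : q.2 = L - 1 := by linarith
    set y := excess σ b q
    have h2 := mul_le_mul_of_nonneg_left h1 hLpos.le
    have e1 : L * (y ^ (m + 2) - (m + 2) * c * y ^ (m + 2) / L + (m + 2) * B q / L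
        + C * (y ^ m / L ^ 2 + 1 / L ^ 3)) = L * y ^ (m + 2) - (m + 2) * c * y ^ (m + 2)
        + (m + 2) * B q + C * (y ^ m / L + 1 / L ^ 2) := by
      field_simp
    rw [e1] at h2
    rw [hlq]
    have h3 : 0 ≤ y ^ m / L + 1 / L ^ 2 := by positivity
    have h4 : 0 ≤ (m + 2) * (y ^ m / L + 1 / L ^ 2) := by positivity
    have h5 : 0 ≤ C * B q := by positivity
    linarith
  · exact meanSum_ne_top_of_le hf hs (a := C + m + 2) (by positivity) hB (by fun_prop)
      (fun q _ => le_rfl) hBsum hsum (meanSum_inv_sq hs)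

end MeanSum

/-! ### Deviations from the fixed point -/

/-- A wrong sign at distance `r` would, since `f` is off `0` and `1` at the endpoints, produce a
second fixed point by the intermediate value theorem; compactness makes the bound uniform. -/
lemma exists_drift_lower_bound {f : ℝ → ℝ} (hfc : Continuous f) (hf01 : ∀ t, f t ∈ Set.Ioo (0 : ℝ) 1)
    {p : ℝ} (huniq : ∀ q ∈ Set.Icc (0 : ℝ) 1, f q = q → q = p)
    {σ r : ℝ} (hσ : σ = 1 ∨ σ = -1) (hr : 0 < r) :
    ∃ κ : ℝ, 0 < κ ∧ ∀ a ∈ Set.Icc (0 : ℝ) 1, r ≤ σ * (a - p) → κ ≤ σ * (a - f a) := by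
  set K : Set ℝ := Set.Icc 0 1 ∩ {a | r ≤ σ * (a - p)} with hK
  have hKc : IsCompact K := isCompact_Icc.inter_right (isClosed_le (by fun_prop) (by fun_prop))
  have hposK : ∀ a ∈ K, 0 < σ * (a - f a) := by
    rintro a ⟨ha, har⟩
    have har' : r ≤ σ * (a - p) := har
    by_contra hcon
    rw [not_lt] at hcon
    rcases hσ with rfl | rfl
    · obtain ⟨t, ht, ht0⟩ := intermediate_value_Icc (f := fun a => a - f a) ha.2
        (by fun_prop : ContinuousOn _ _)
        (show (0 : ℝ) ∈ Set.Icc (a - f a) (1 - f 1) from ⟨by linarith, by linarith [(hf01 1).2]⟩)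
      have := huniq t ⟨ha.1.trans ht.1, ht.2⟩ (by simp only at ht0; linarith)
      linarith [ht.1]
    · obtain ⟨t, ht, ht0⟩ := intermediate_value_Icc (f := fun a => a - f a) ha.1
        (by fun_prop : ContinuousOn _ _)
        (show (0 : ℝ) ∈ Set.Icc (0 - f 0) (a - f a) from ⟨by linarith [(hf01 0).1], by linarith⟩)
      have := huniq t ⟨ht.1, ht.2.trans ha.2⟩ (by simp only at ht0; linarith)
      linarith [ht.2]
  rcases K.eq_empty_or_nonempty with hE | hne
  · refine ⟨1, one_pos, fun a ha har => ?_⟩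
    have : a ∈ K := ⟨ha, har⟩
    rw [hE] at this
    exact absurd this (Set.notMem_empty a)
  · obtain ⟨a₀, ha₀, hmin⟩ := hKc.exists_isMinOn hne
      (by fun_prop : ContinuousOn (fun a => σ * (a - f a)) K)
    exact ⟨_, hposK a₀ ha₀, fun a ha har => hmin (show a ∈ K from ⟨ha, har⟩)⟩

/-- Being at distance at least `r` from `p`. -/
noncomputable def far (p r : ℝ) (q : UrnState) : ℝ := if r ≤ |q.1 - p| then 1 else 0

lemma far_nonneg (p r : ℝ) (q : UrnState) : 0 ≤ far p r q := by unfold far; split_ifs <;> norm_num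

lemma measurable_far (p r : ℝ) : Measurable (far p r) :=
  Measurable.ite (measurableSet_le (by fun_prop) (by fun_prop)) measurable_const measurable_const

/-- Deviations from the unique fixed point are summable. -/
lemma meanSum_far {f : ℝ → ℝ} (hfc : Continuous f) (hf01 : ∀ t, f t ∈ Set.Ioo (0 : ℝ) 1)
    {p : ℝ} (hp : p ∈ Set.Icc (0 : ℝ) 1) (huniq : ∀ q ∈ Set.Icc (0 : ℝ) 1, f q = q → q = p)
    {s : UrnState} (hs : IsUrnState s) {r : ℝ} (hr : 0 < r) : meanSum f s (far p r) ≠ ⊤ := by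
  have hf' : ∀ t, f t ∈ Set.Icc (0 : ℝ) 1 := fun t => Set.Ioo_subset_Icc_self (hf01 t)
  have side : ∀ σ : ℝ, σ = 1 ∨ σ = -1 →
      ∃ m : ℕ, meanSum f s (fun q => excess σ (p + σ * (r / 2)) q ^ (m + 2)) ≠ ⊤ := by
    intro σ hσ
    obtain ⟨κ, hκ, hbound⟩ := exists_drift_lower_bound hfc hf01 huniq hσ (half_pos hr)
    have hσσ : σ * σ = 1 := by rcases hσ with rfl | rfl <;> norm_num
    have hx : ∀ q : UrnState, σ * (q.1 - (p + σ * (r / 2))) = σ * (q.1 - p) - r / 2 := by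
      intro q
      linear_combination (-(r / 2)) * hσσ
    have hx1 : ∀ q : UrnState, IsUrnState q → σ * (q.1 - (p + σ * (r / 2))) ≤ 1 := by
      intro q hq
      obtain ⟨⟨h0, h1⟩, -⟩ := hq
      rw [hx]
      obtain ⟨hp0, hp1⟩ := hp
      rcases hσ with rfl | rfl <;> linarith
    -- Measured from `r / 2` beyond `p`, the excess `x` is at most `1`, so the constant pull `κ`
    -- dominates the linear one: `κ x ≥ κ x ^ 2`.
    have hD : HasDrift f σ (p + σ * (r / 2)) κ fun _ => 0 := by
      refine ⟨by rcases hσ with rfl | rfl <;> norm_num, hx1, fun _ _ => le_rfl, fun q hq => ?_⟩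
      rcases le_or_gt (σ * (q.1 - (p + σ * (r / 2)))) 0 with h0 | h0
      · simp [excess, max_eq_right h0]
      · have he : excess σ (p + σ * (r / 2)) q = σ * (q.1 - (p + σ * (r / 2))) := max_eq_left h0.le
        have h1 := hx1 q hq
        rw [he]
        set x := σ * (q.1 - (p + σ * (r / 2))) with hxd
        have h2 := hbound q.1 hq.1 (by rw [hx] at hxd; linarith)
        nlinarith [mul_nonneg hκ.le (mul_nonneg h0.le (sub_nonneg.2 h1))]
    -- `κ` may be tiny; a high power compensates for it.
    obtain ⟨N, hN⟩ := exists_nat_gt (1 / κ)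
    have hN' : 1 < N * κ := by rwa [div_lt_iff₀ hκ] at hN
    refine ⟨N + 2, hD.meanSum_pow hfc.measurable hf' hs (N + 2) (by push_cast; nlinarith)
      measurable_const meanSum_zero ?_⟩
    refine meanSum_ne_top_of_le hfc.measurable hs (a := 1) zero_le_one
      (g₁ := fun q => excess σ (p + σ * (r / 2)) q ^ 2 / (q.2 + 1)) (g₂ := fun _ => 0)
      (g₃ := fun _ => 0) ?_ measurable_const (fun q hq => ?_)
      (hD.meanSum_sq_div hfc.measurable hf' hs hκ) meanSum_zero meanSum_zero
    · have := measurable_excess σ (p + σ * (r / 2)); fun_prop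
    · have h1 : excess σ (p + σ * (r / 2)) q ≤ 1 := max_le (hx1 q hq) zero_le_one
      have h2 := pow_le_pow_of_le_one (excess_nonneg σ (p + σ * (r / 2)) q) h1
        (by omega : 2 ≤ N + 2)
      have := hq.2
      simp only [add_zero, one_mul]
      gcongr
  obtain ⟨m₁, h₁⟩ := side 1 (Or.inl rfl)
  obtain ⟨m₂, h₂⟩ := side (-1) (Or.inr rfl)
  have hm₁ := measurable_excess 1 (p + 1 * (r / 2))
  have hm₂ := measurable_excess (-1) (p + -1 * (r / 2))
  refine meanSum_ne_top_of_le hfc.measurable hs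
    (a := 1 / (r / 2) ^ (m₁ + 2) + 1 / (r / 2) ^ (m₂ + 2)) (by positivity)
    (g₃ := fun _ => 0) (by fun_prop) (by fun_prop) (fun q hq => ?_) h₁ h₂ meanSum_zero
  have hn₁ := excess_nonneg 1 (p + 1 * (r / 2)) q
  have hn₂ := excess_nonneg (-1) (p + -1 * (r / 2)) q
  unfold far
  split_ifs with hfar
  · rcases le_abs.1 hfar with h | h
    · have : r / 2 ≤ excess 1 (p + 1 * (r / 2)) q := le_max_of_le_left (by linarith)
      have h3 := pow_le_pow_left₀ (by positivity) this (m₁ + 2)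
      calc (1 : ℝ) = 1 / (r / 2) ^ (m₁ + 2) * (r / 2) ^ (m₁ + 2) := by field_simp
        _ ≤ 1 / (r / 2) ^ (m₁ + 2) * excess 1 (p + 1 * (r / 2)) q ^ (m₁ + 2) := by gcongr
        _ ≤ _ := by
          gcongr
          · exact le_add_of_nonneg_right (by positivity)
          · rw [add_zero]; exact le_add_of_nonneg_right (by positivity)
    · have : r / 2 ≤ excess (-1) (p + -1 * (r / 2)) q := le_max_of_le_left (by linarith)
      have h3 := pow_le_pow_left₀ (by positivity) this (m₂ + 2)
      calc (1 : ℝ) = 1 / (r / 2) ^ (m₂ + 2) * (r / 2) ^ (m₂ + 2) := by field_simp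
        _ ≤ 1 / (r / 2) ^ (m₂ + 2) * excess (-1) (p + -1 * (r / 2)) q ^ (m₂ + 2) := by gcongr
        _ ≤ _ := by
          gcongr
          · exact le_add_of_nonneg_left (by positivity)
          · rw [add_zero]; exact le_add_of_nonneg_left (by positivity)
  · positivity

/-- Near a fixed point at which `f` is flat, the third moments of the deviations are summable. -/
lemma meanSum_cube {f : ℝ → ℝ} (hfc : Continuous f) (hf01 : ∀ t, f t ∈ Set.Ioo (0 : ℝ) 1)
    {p : ℝ} (hp : p ∈ Set.Icc (0 : ℝ) 1) (huniq : ∀ q ∈ Set.Icc (0 : ℝ) 1, f q = q → q = p)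
    {s : UrnState} (hs : IsUrnState s) {r : ℝ} (hr : 0 < r)
    (hflat : ∀ a, |a - p| < r → |f a - p| ≤ |a - p| / 10) :
    meanSum f s (fun q => |q.1 - p| ^ 3) ≠ ⊤ := by
  have hf' : ∀ t, f t ∈ Set.Icc (0 : ℝ) 1 := fun t => Set.Ioo_subset_Icc_self (hf01 t)
  have hfar := meanSum_far hfc hf01 hp huniq hs hr
  have hmf := measurable_far p r
  have side : ∀ σ : ℝ, σ = 1 ∨ σ = -1 → meanSum f s (fun q => excess σ p q ^ 3) ≠ ⊤ := by
    intro σ hσ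
    have habs : |σ| = 1 := by rcases hσ with rfl | rfl <;> norm_num
    have hx1 : ∀ q : UrnState, IsUrnState q → σ * (q.1 - p) ≤ 1 := by
      intro q hq
      obtain ⟨⟨h0, h1⟩, -⟩ := hq
      obtain ⟨hp0, hp1⟩ := hp
      rcases hσ with rfl | rfl <;> linarith
    -- Flatness gives a pull of strength at least `1 - 1/10` near `p`; elsewhere the error `2`
    -- covers everything and is summable by `meanSum_far`.
    have hD : HasDrift f σ p (9 / 10) fun q => 2 * far p r q := by
      refine ⟨habs, hx1, fun q _ => mul_nonneg zero_le_two (far_nonneg _ _ _), fun q hq => ?_⟩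
      have hn := excess_nonneg σ p q
      have hle : excess σ p q ≤ 1 := max_le (hx1 q hq) zero_le_one
      by_cases hfarq : r ≤ |q.1 - p|
      · rw [far, if_pos hfarq]
        have h1 : σ * (f q.1 - q.1) ≤ 1 := by
          obtain ⟨⟨h0, h1⟩, -⟩ := hq
          obtain ⟨h2, h3⟩ := hf' q.1
          rcases hσ with rfl | rfl <;> linarith
        nlinarith
      · rw [far, if_neg hfarq, mul_zero, add_zero]
        rcases le_or_gt (σ * (q.1 - p)) 0 with h0 | h0
        · simp [excess, max_eq_right h0]
        · have he : excess σ p q = σ * (q.1 - p) := max_eq_left h0.le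
          have h1 := hflat q.1 (not_le.1 hfarq)
          have h2 : |q.1 - p| = σ * (q.1 - p) := by
            rw [← abs_of_pos h0, abs_mul, habs, one_mul]
          have h3 : σ * (f q.1 - p) ≤ |f q.1 - p| := by
            calc _ ≤ |σ * (f q.1 - p)| := le_abs_self _
              _ = _ := by rw [abs_mul, habs, one_mul]
          rw [he]
          have h4 : σ * (f q.1 - q.1) ≤ -(9 / 10 * (σ * (q.1 - p))) := by
            rw [h2] at h1
            linarith
          nlinarith
    have hB : meanSum f s (fun q => 2 * far p r q) ≠ ⊤ :=
      meanSum_ne_top_of_le hfc.measurable hs (a := 2) zero_le_two (g₂ := fun _ => 0)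
        (g₃ := fun _ => 0) hmf measurable_const (fun q _ => by simp) hfar meanSum_zero meanSum_zero
    have hme := measurable_excess σ p
    refine hD.meanSum_pow hfc.measurable hf' hs 1 (by norm_num) (by fun_prop) hB ?_
    refine meanSum_ne_top_of_le hfc.measurable hs (a := 1) zero_le_one
      (g₁ := fun q => excess σ p q ^ 2 / √(q.2 + 1))
      (g₂ := fun q => 1 / ((q.2 + 1) * √(q.2 + 1)))
      (g₃ := fun _ => 0) (by fun_prop) (by fun_prop) (fun q hq => ?_)
      (hD.meanSum_sq_div_sqrt hfc.measurable hf' hs (by norm_num) (by fun_prop) hB)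
      (meanSum_inv_mul_sqrt hs) meanSum_zero
    have hl := hq.2
    have hLpos : 0 < q.2 + 1 := by linarith
    have hw : 0 < √(q.2 + 1) := Real.sqrt_pos.2 hLpos
    have hw2 : q.2 + 1 = √(q.2 + 1) ^ 2 := (Real.sq_sqrt hLpos.le).symm
    set w := √(q.2 + 1)
    rw [hw2, pow_one, add_zero, one_mul]
    have hy := excess_nonneg σ p q
    set y := excess σ p q
    -- The inequality `y / L ≤ y ^ 2 / √L + 1 / (L √L)` as a completed square.
    have e : y ^ 2 / w + 1 / (w ^ 2 * w) - y / w ^ 2 = ((y * w - 1) ^ 2 + y * w) / w ^ 3 := by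
      field_simp
      ring
    have : 0 ≤ ((y * w - 1) ^ 2 + y * w) / w ^ 3 := by positivity
    linarith
  have hm₁ := measurable_excess 1 p
  have hm₂ := measurable_excess (-1) p
  refine meanSum_ne_top_of_le hfc.measurable hs (a := 1) zero_le_one
    (g₃ := fun _ => 0) (by fun_prop) (by fun_prop) (fun q _ => ?_)
    (side 1 (Or.inl rfl)) (side (-1) (Or.inr rfl)) meanSum_zero
  have hn₁ := pow_nonneg (excess_nonneg 1 p q) 3
  have hn₂ := pow_nonneg (excess_nonneg (-1) p q) 3
  rcases le_total 0 (q.1 - p) with h | h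
  · have : excess 1 p q = |q.1 - p| := by rw [excess, one_mul, max_eq_left h, abs_of_nonneg h]
    rw [this] at hn₁ ⊢
    linarith
  · have : excess (-1) p q = |q.1 - p| := by
      rw [excess, neg_one_mul, max_eq_left (by linarith), abs_of_nonpos h]
    rw [this] at hn₂ ⊢
    linarith

/-! ### The total drift -/

lemma coe_sum_eq_sub (g : ℕ → ℝ) (n : ℕ) :
    ((∑ k ∈ Finset.range n, g k : ℝ) : EReal) =
      ((∑ k ∈ Finset.range n, ENNReal.ofReal (g k) : ℝ≥0∞) : EReal) -
        ((∑ k ∈ Finset.range n, ENNReal.ofReal (-g k) : ℝ≥0∞) : EReal) := by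
  have h : ∀ a : ℕ → ℝ, ((∑ k ∈ Finset.range n, ENNReal.ofReal (a k) : ℝ≥0∞) : EReal) =
      ((∑ k ∈ Finset.range n, max (a k) 0 : ℝ) : EReal) := by
    intro a
    have : ∀ k, ENNReal.ofReal (a k) = ENNReal.ofReal (max (a k) 0) := by
      intro k
      rcases le_total (a k) 0 with h | h
      · rw [max_eq_right h, ENNReal.ofReal_of_nonpos h, ENNReal.ofReal_zero]
      · rw [max_eq_left h]
    rw [Finset.sum_congr rfl fun k _ => this k,
      ← ENNReal.ofReal_sum_of_nonneg fun k _ => le_max_right _ _, EReal.coe_ennreal_ofReal,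
      max_eq_left (Finset.sum_nonneg fun k _ => le_max_right _ _)]
  rw [h, h, ← EReal.coe_sub, ← Finset.sum_sub_distrib]
  congr 2
  funext k
  rcases le_total (g k) 0 with h | h
  · rw [max_eq_right h, max_eq_left (by linarith)]; ring
  · rw [max_eq_left h, max_eq_right (by linarith)]; ring

lemma tendsto_coe_sum (g : ℕ → ℝ)
    (h : ∑' k, ENNReal.ofReal (g k) ≠ ⊤ ∨ ∑' k, ENNReal.ofReal (-g k) ≠ ⊤) :
    Tendsto (fun n : ℕ => ((∑ k ∈ Finset.range (n + 1), g k : ℝ) : EReal)) atTop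
      (𝓝 (((∑' k, ENNReal.ofReal (g k) : ℝ≥0∞) : EReal) -
        ((∑' k, ENNReal.ofReal (-g k) : ℝ≥0∞) : EReal))) := by
  simp only [coe_sum_eq_sub, sub_eq_add_neg]
  have h1 : Tendsto (fun n : ℕ => ((∑ k ∈ Finset.range (n + 1), ENNReal.ofReal (g k) : ℝ≥0∞) : EReal))
      atTop (𝓝 ((∑' k, ENNReal.ofReal (g k) : ℝ≥0∞) : EReal)) :=
    EReal.tendsto_coe_ennreal.2 ((tendsto_add_atTop_iff_nat 1).2 (ENNReal.tendsto_nat_tsum _))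
  have h2 : Tendsto (fun n : ℕ => -((∑ k ∈ Finset.range (n + 1), ENNReal.ofReal (-g k) : ℝ≥0∞) : EReal))
      atTop (𝓝 (-((∑' k, ENNReal.ofReal (-g k) : ℝ≥0∞) : EReal))) :=
    (continuous_neg.tendsto _).comp (EReal.tendsto_coe_ennreal.2
      ((tendsto_add_atTop_iff_nat 1).2 (ENNReal.tendsto_nat_tsum _)))
  refine (EReal.continuousAt_add ?_ ?_).tendsto.comp (h1.prodMk_nhds h2)
  · simpa using h
  · simp

lemma toENNReal_coe_sub (P N : ℝ≥0∞) : ((P : EReal) - (N : EReal)).toENNReal = P - N := by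
  rw [EReal.toENNReal_sub (EReal.coe_ennreal_nonneg N), EReal.toENNReal_coe, EReal.toENNReal_coe]

lemma neg_coe_sub {P N : ℝ≥0∞} (h : P ≠ ⊤ ∨ N ≠ ⊤) :
    -((P : EReal) - (N : EReal)) = (N : EReal) - (P : EReal) := by
  rw [EReal.neg_sub (Or.inl (by simp)) (by simpa using h), add_comm, sub_eq_add_neg]

section Drift

variable {f : ℝ → ℝ} {w : ℤ → UrnState}

/-- The increment of the drift in a given state of the urn. -/
def driftIncrement (f : ℝ → ℝ) (q : UrnState) : ℝ := 2 * f q.1 - 1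

lemma measurable_driftIncrement (hf : Measurable f) : Measurable (driftIncrement f) := by
  unfold driftIncrement; fun_prop

lemma map_sampleMeasure (x : ℤ) : sampleMeasure.map (fun ω => ω x) = drawMeasure :=
  Measure.infinitePi_map_eval (fun _ : ℤ => Measure.infinitePi fun _ : ℕ =>
    (volume : Measure unitInterval)) x

instance : IsProbabilityMeasure sampleMeasure := by unfold sampleMeasure; infer_instance

lemma measurable_alpha (hf : Measurable f) (x : ℤ) (k : ℕ) :
    Measurable fun ω : Sample => alpha f w ω x k :=
  ((measurable_urn hf (w x) k).comp (measurable_pi_apply x)).fst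

lemma measurable_driftPos (hf : Measurable f) (x : ℤ) : Measurable (driftPos f w x) := by
  refine Measurable.tsum fun k => ?_
  have := measurable_alpha (w := w) hf x k
  fun_prop

lemma measurable_driftNeg (hf : Measurable f) (x : ℤ) : Measurable (driftNeg f w x) := by
  refine Measurable.tsum fun k => ?_
  have := measurable_alpha (w := w) hf x k
  fun_prop

lemma lintegral_driftPos (hf : Measurable f) (x : ℤ) :
    ∫⁻ ω, driftPos f w x ω ∂sampleMeasure = meanSum f (w x) (driftIncrement f) := by
  have hm := measurable_driftIncrement hf
  unfold driftPos meanSum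
  rw [lintegral_tsum fun k => by
    have := measurable_alpha (w := w) hf x k
    fun_prop]
  refine tsum_congr fun k => ?_
  have hu := measurable_urn hf (w x) k
  rw [← map_sampleMeasure x, lintegral_map (by fun_prop) (measurable_pi_apply x)]
  rfl

lemma lintegral_driftNeg (hf : Measurable f) (x : ℤ) :
    ∫⁻ ω, driftNeg f w x ω ∂sampleMeasure = meanSum f (w x) (fun q => -driftIncrement f q) := by
  have hm := measurable_driftIncrement hf
  unfold driftNeg meanSum
  rw [lintegral_tsum fun k => by
    have := measurable_alpha (w := w) hf x k
    fun_prop]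
  refine tsum_congr fun k => ?_
  have hu := measurable_urn hf (w x) k
  rw [← map_sampleMeasure x, lintegral_map (by fun_prop) (measurable_pi_apply x)]
  rfl

lemma tendsto_drift {x : ℤ} {ω : Sample} (h : driftPos f w x ω ≠ ⊤ ∨ driftNeg f w x ω ≠ ⊤) :
    Tendsto (fun n : ℕ => (drift f w x n ω : EReal)) atTop
      (𝓝 ((driftPos f w x ω : EReal) - (driftNeg f w x ω : EReal))) :=
  tendsto_coe_sum (fun k => 2 * f (alpha f w ω x k) - 1) h

lemma driftLimit_eq {x : ℤ} {ω : Sample} (h : driftPos f w x ω ≠ ⊤ ∨ driftNeg f w x ω ≠ ⊤) :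
    driftLimit f w x ω = (driftPos f w x ω : EReal) - (driftNeg f w x ω : EReal) :=
  (tendsto_drift h).liminf_eq

variable {x : ℤ}

lemma ae_drift_ne_top (hf : Measurable f) (h : meanSum f (w x) (driftIncrement f) ≠ ⊤ ∨
    meanSum f (w x) (fun q => -driftIncrement f q) ≠ ⊤) :
    ∀ᵐ ω ∂sampleMeasure, driftPos f w x ω ≠ ⊤ ∨ driftNeg f w x ω ≠ ⊤ := by
  rcases h with h | h
  · rw [← lintegral_driftPos hf] at h
    filter_upwards [ae_lt_top (measurable_driftPos hf x) h] with ω hω using Or.inl hω.ne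
  · rw [← lintegral_driftNeg hf] at h
    filter_upwards [ae_lt_top (measurable_driftNeg hf x) h] with ω hω using Or.inr hω.ne

lemma driftWellDefined_of_ne_top (hf : Measurable f)
    (h : meanSum f (w x) (driftIncrement f) ≠ ⊤ ∨
      meanSum f (w x) (fun q => -driftIncrement f q) ≠ ⊤) :
    DriftWellDefined f w x := by
  have hae := ae_drift_ne_top hf h
  refine ⟨?_, ?_, ?_⟩
  · filter_upwards [hae] with ω hω
    rw [driftLimit_eq hω]
    exact tendsto_drift hω
  · rw [lintegral_driftPos hf, lintegral_driftNeg hf]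
    simpa only [lt_top_iff_ne_top] using h
  · refine h.imp (fun h => ?_) fun h => ?_
    · rw [← lintegral_driftPos hf] at h
      refine lt_of_le_of_lt (lintegral_mono_ae ?_) h.lt_top
      filter_upwards [hae] with ω hω
      rw [driftLimit_eq hω, toENNReal_coe_sub]
      exact tsub_le_self
    · rw [← lintegral_driftNeg hf] at h
      refine lt_of_le_of_lt (lintegral_mono_ae ?_) h.lt_top
      filter_upwards [hae] with ω hω
      rw [driftLimit_eq hω, neg_coe_sub hω, toENNReal_coe_sub]
      exact tsub_le_self

/-- Balance between the positive and negative parts of the limit drift and those of its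
increments. -/
lemma lintegral_driftLimit_add (hf : Measurable f)
    (h : meanSum f (w x) (driftIncrement f) ≠ ⊤ ∨
      meanSum f (w x) (fun q => -driftIncrement f q) ≠ ⊤) :
    ∫⁻ ω, (driftLimit f w x ω).toENNReal ∂sampleMeasure +
        meanSum f (w x) (fun q => -driftIncrement f q) =
      ∫⁻ ω, (-driftLimit f w x ω).toENNReal ∂sampleMeasure +
        meanSum f (w x) (driftIncrement f) := by
  rw [← lintegral_driftPos hf, ← lintegral_driftNeg hf,
    ← lintegral_add_right _ (measurable_driftNeg hf x),
    ← lintegral_add_right _ (measurable_driftPos hf x)]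
  refine lintegral_congr_ae ?_
  filter_upwards [ae_drift_ne_top hf h] with ω hω
  -- With truncated subtraction, `(P - N) + N` and `(N - P) + P` are both `max P N`.
  rw [driftLimit_eq hω, neg_coe_sub hω, toENNReal_coe_sub, toENNReal_coe_sub, tsub_add_eq_max,
    tsub_add_eq_max, max_comm]

lemma add_lt_of_coe_lt_sub {a b : ℝ≥0∞} (h : (1 : EReal) < (a : EReal) - (b : EReal)) :
    b ≠ ⊤ ∧ 1 + b < a := by
  have hb : b ≠ ⊤ := by
    rintro rfl
    simp at h
  refine ⟨hb, ?_⟩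
  have h1 := EReal.add_lt_of_lt_sub h
  exact_mod_cast h1

/-- Passes from the parts of the limit, which define its expectation, to the summed parts of the
increments, which drive the chain. Finiteness of `b` and of one of `P`, `N` allows cancellation. -/
lemma one_add_lt_of_balance {a b P N : ℝ≥0∞} (hbal : a + N = b + P) (hPN : P ≠ ⊤ ∨ N ≠ ⊤)
    (hb : b ≠ ⊤) (h : 1 + b < a) : 1 + N < P := by
  have hN : N ≠ ⊤ := by
    rcases hPN with hP | hN
    · have : a + N ≠ ⊤ := hbal ▸ ENNReal.add_ne_top.2 ⟨hb, hP⟩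
      exact (ENNReal.add_ne_top.1 this).2
    · exact hN
  have h1 : b + (1 + N) < b + P := by
    rw [← hbal]
    calc b + (1 + N) = (1 + b) + N := by ring
      _ < a + N := (ENNReal.add_lt_add_iff_right hN).2 h
  exact lt_of_add_lt_add_left h1

lemma one_add_lt_of_one_lt_expectation (hf : Measurable f)
    (h : meanSum f (w x) (driftIncrement f) ≠ ⊤ ∨
      meanSum f (w x) (fun q => -driftIncrement f q) ≠ ⊤)
    (hE : 1 < expectation sampleMeasure (driftLimit f w x)) :
    1 + meanSum f (w x) (fun q => -driftIncrement f q) < meanSum f (w x) (driftIncrement f) := by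
  obtain ⟨hb, hlt⟩ := add_lt_of_coe_lt_sub hE
  exact one_add_lt_of_balance (lintegral_driftLimit_add hf h) h hb hlt

lemma one_add_lt_of_expectation_lt_neg_one (hf : Measurable f)
    (h : meanSum f (w x) (driftIncrement f) ≠ ⊤ ∨
      meanSum f (w x) (fun q => -driftIncrement f q) ≠ ⊤)
    (hE : expectation sampleMeasure (driftLimit f w x) < -1) :
    1 + meanSum f (w x) (driftIncrement f) < meanSum f (w x) (fun q => -driftIncrement f q) := by
  have hfin : ∫⁻ ω, (driftLimit f w x ω).toENNReal ∂sampleMeasure ≠ ⊤ ∨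
      ∫⁻ ω, (-driftLimit f w x ω).toENNReal ∂sampleMeasure ≠ ⊤ := by
    simpa only [HasExpectation, lt_top_iff_ne_top] using (driftWellDefined_of_ne_top hf h).2.2
  have hE' : (1 : EReal) < -expectation sampleMeasure (driftLimit f w x) := EReal.lt_neg_comm.1 hE
  rw [expectation, neg_coe_sub hfin] at hE'
  obtain ⟨hb, hlt⟩ := add_lt_of_coe_lt_sub hE'
  exact one_add_lt_of_balance (lintegral_driftLimit_add hf h).symm h.symm hb hlt

end Drift

/-! ### Transience under a large drift -/

/-- If the mean of the total drift at each site is larger than `1`, almost surely some site is never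
crossed back. -/
lemma IsCompensated.ae_exists_backward_eq_zero {S Ω : Type*} [MeasurableSpace S] [MeasurableSpace Ω]
    {μ : Measure S} [IsProbabilityMeasure μ] {P : Measure Ω} [IsProbabilityMeasure P]
    {r : S → ℕ → Bool} {φ : ℕ → S → ℝ} {ε : ℝ} (h : IsCompensated μ r φ ε)
    (hd : 1 + ∑' k, ∫⁻ s, ENNReal.ofReal (-(2 * φ k s - 1)) ∂μ
      < ∑' k, ∫⁻ s, ENNReal.ofReal (2 * φ k s - 1) ∂μ)
    {X : ℕ → Ω → S} (hX : ∀ i, Measurable (X i)) (hind : iIndepFun X P)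
    (hlaw : ∀ i, P.map (X i) = μ) :
    ∀ᵐ ω ∂P, (∃ i, ∀ n, backward (fun k => r (X k ω)) n i = 0) ∧ ∀ k, InfinitelyRed (r (X k ω)) := by
  obtain ⟨K, η, C, hη, hηtop, hC, hdrift⟩ := h.exists_lintegral_failures_le hd
  have hr := h.measurable_draw
  have : IsProbabilityMeasure (μ.map r) := Measure.isProbabilityMeasure_map hr.aemeasurable
  have hinf : ∀ᵐ ω ∂P, ∀ k, InfinitelyRed (r (X k ω)) := by
    refine ae_all_iff.2 fun k => ?_
    have := h.ae_infinitelyRed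
    rw [← hlaw k] at this
    exact ae_of_ae_map (hX k).aemeasurable this
  have hinfν : ∀ᵐ b ∂(μ.map r), InfinitelyRed b := by
    have hle : {b | InfinitelyRed b} = ⋂ j : ℕ, ⋃ k : ℕ, {b | j < reds b k} := by
      ext b
      simp only [Set.mem_ofPred_eq, Set.mem_iInter, Set.mem_iUnion]
      refine ⟨fun hb j => ?_, infinitelyRed_of_forall⟩
      refine ⟨Nat.nth (fun i => b i = true) j + 1, ?_⟩
      exact not_le.1 fun hle => by have := (reds_le_iff hb).1 hle; omega
    have hm : MeasurableSet {b | InfinitelyRed b} := by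
      rw [hle]
      exact MeasurableSet.iInter fun j => MeasurableSet.iUnion fun k =>
        measurableSet_lt measurable_const (measurable_reds k)
    exact (ae_map_iff hr.aemeasurable hm).2 h.ae_infinitelyRed
  have hred : ∀ K : ℕ, 0 < (μ.map r) {b | reds b K = K} := by
    intro K
    rw [Measure.map_apply hr (measurableSet_eq_fun (measurable_reds K) measurable_const)]
    exact h.measure_all_red_pos K
  have hdrift' : ∀ j : ℕ, ∫⁻ b, (failures b j : ℝ≥0∞) ∂(μ.map r) + η ≤
      j + if j < K then C else 0 := by
    intro j
    have hm : Measurable fun b : ℕ → Bool => (failures b j : ℝ≥0∞) :=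
      (measurable_of_countable (fun n : ℕ => (n : ℝ≥0∞))).comp (measurable_failures j)
    rw [lintegral_map hm hr]
    exact hdrift j
  have key := RRW.ae_exists_backward_eq_zero (P := P) (B := fun i ω => r (X i ω)) (ν := μ.map r)
    (fun i => hr.comp (hX i)) (hind.comp (fun _ => r) fun _ => hr)
    (fun i => by rw [← hlaw i, Measure.map_map hr (hX i)]; rfl) hinfν hred hη hηtop hC
    hdrift'
  filter_upwards [key, hinf] with ω h1 h2 using ⟨h1, h2⟩

section Transience

variable {f : ℝ → ℝ} {w : ℤ → UrnState} {ε : ℝ}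

lemma walkState_succ (f : ℝ → ℝ) (w : ℤ → UrnState) (ω : Sample) (n : ℕ) :
    walkState f w ω (n + 1) =
      (if draws f (w (walk f w ω n)) (ω (walk f w ω n))
          ((walkState f w ω n).2 (walk f w ω n)) = true
        then walk f w ω n + 1 else walk f w ω n - 1,
      Function.update (walkState f w ω n).2 (walk f w ω n)
        ((walkState f w ω n).2 (walk f w ω n) + 1)) := by
  by_cases h : (ω (walk f w ω n) ((walkState f w ω n).2 (walk f w ω n)) : ℝ) <
    f (alpha f w ω (walk f w ω n) ((walkState f w ω n).2 (walk f w ω n)))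
  · rw [if_pos (by simpa [draws, alpha] using h)]
    exact Prod.ext (if_pos h) rfl
  · rw [if_neg (by simpa [draws, alpha] using h)]
    exact Prod.ext (if_neg h) rfl

lemma iIndepFun_sites {g : ℕ → ℤ} (hg : Function.Injective g) :
    iIndepFun (fun (i : ℕ) (ω : Sample) => ω (g i)) sampleMeasure := by
  have h : iIndepFun (fun (x : ℤ) (ω : Sample) => ω x) sampleMeasure :=
    iIndepFun_infinitePi (X := fun _ u => u) fun _ => measurable_id
  exact h.precomp hg

lemma measure_recurrence_eq_zero_of_right (hf : Measurable f) (hε : 0 < ε) (hfε : ∀ t, ε ≤ f t)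
    (hf1 : ∀ t, f t ≤ 1) (hright : ∀ x : ℤ, 1 ≤ x → w x = w 1)
    (hd : 1 + meanSum f (w 1) (fun q => -driftIncrement f q) <
      meanSum f (w 1) (driftIncrement f)) :
    sampleMeasure (recurrence f w) = 0 := by
  have hcomp := isCompensated_draws hf hε hfε hf1 (w 1)
  have key := hcomp.ae_exists_backward_eq_zero hd (P := sampleMeasure)
    (X := fun (i : ℕ) ω => ω (i + 1)) (fun i => measurable_pi_apply _)
    (iIndepFun_sites fun a b h => by simpa using h) (fun i => map_sampleMeasure _)
  rw [← compl_compl (recurrence f w)]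
  change ∀ᵐ ω ∂sampleMeasure, ω ∈ (recurrence f w)ᶜ
  filter_upwards [key] with ω ⟨⟨i, hi⟩, hinf⟩ hrec
  have hw : ∀ k : ℕ, draws f (w (k + 1)) (ω (k + 1)) = draws f (w 1) (ω (k + 1)) := fun k => by
    rw [hright (k + 1) (by omega)]
  obtain ⟨n, hn⟩ := exists_backward_ne_zero (b := fun x => draws f (w x) (ω x))
    (pos := walk f w ω) (loc := fun n => (walkState f w ω n).2) rfl (fun _ => rfl)
    (fun n => by rw [walk, walkState_succ]) (fun n => by rw [walkState_succ])
    (fun k => by simp only [hw]; exact hinf k) hrec i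
  simp only [hw] at hn
  exact hn (hi n)

/-- The reflected walk `-X` follows the draws with the colours exchanged, and the drift changes
sign. -/
lemma measure_recurrence_eq_zero_of_left (hf : Measurable f) (hε : 0 < ε) (hfε : ∀ t, ε ≤ f t)
    (hf1 : ∀ t, f t ≤ 1 - ε) (hleft : ∀ x : ℤ, x ≤ -1 → w x = w (-1))
    (hd : 1 + meanSum f (w (-1)) (driftIncrement f) <
      meanSum f (w (-1)) (fun q => -driftIncrement f q)) :
    sampleMeasure (recurrence f w) = 0 := by
  have hcomp := (isCompensated_draws hf hε hfε (fun t => (hf1 t).trans (by linarith))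
    (w (-1))).flip hε (fun k u => hf1 _)
  have hsum : ∀ k u, 2 * (1 - f (urn f (w (-1)) u k).1) - 1 =
      -driftIncrement f (urn f (w (-1)) u k) := fun k u => by
    rw [driftIncrement]; ring
  have key := hcomp.ae_exists_backward_eq_zero (by
      simp only [hsum, neg_neg]
      exact hd) (P := sampleMeasure)
    (X := fun (i : ℕ) ω => ω (-(i + 1))) (fun i => measurable_pi_apply _)
    (iIndepFun_sites fun a b h => by simpa using h) (fun i => map_sampleMeasure _)
  rw [← compl_compl (recurrence f w)]
  change ∀ᵐ ω ∂sampleMeasure, ω ∈ (recurrence f w)ᶜ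
  filter_upwards [key] with ω ⟨⟨i, hi⟩, hinf⟩ hrec
  have hw : ∀ k : ℕ, draws f (w (-(k + 1))) (ω (-(k + 1))) = draws f (w (-1)) (ω (-(k + 1))) :=
    fun k => by rw [hleft (-(k + 1)) (by omega)]
  obtain ⟨n, hn⟩ := exists_backward_ne_zero (b := fun x k => !draws f (w (-x)) (ω (-x)) k)
    (pos := fun n => -walk f w ω n) (loc := fun n x => (walkState f w ω n).2 (-x)) rfl
    (fun _ => rfl)
    (fun n => by
      simp only [neg_neg]
      rw [walk, walkState_succ]
      cases draws f (w (walk f w ω n)) (ω (walk f w ω n))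
        ((walkState f w ω n).2 (walk f w ω n)) <;> simp <;> ring)
    (fun n => by
      funext x
      rw [walkState_succ]
      simp only [neg_neg, Function.update_apply]
      congr 1
      exact propext neg_eq_iff_eq_neg)
    (fun k => by simp only [hw]; exact hinf k)
    (fun x => (hrec (-x)).mono fun n hn => by rw [hn, neg_neg]) i
  simp only [hw] at hn
  exact hn (hi n)

end Transience

/-! ### Local behaviour of `f` at its fixed point -/

/-- The mean value inequality on the ball of radius `|a - c|`; applied twice, it carries a linear
bound on `f''` to a cubic one on `f`. -/
lemma abs_sub_le_of_abs_deriv_le {g : ℝ → ℝ} {c r C : ℝ} (n : ℕ) (hC : 0 ≤ C)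
    (hg : ∀ a, |a - c| < r → DifferentiableAt ℝ g a)
    (hg' : ∀ a, |a - c| < r → |deriv g a| ≤ C * |a - c| ^ n) {a : ℝ} (ha : |a - c| < r) :
    |g a - g c| ≤ C * |a - c| ^ (n + 1) := by
  have hin : ∀ x ∈ Metric.closedBall c |a - c|, |x - c| ≤ |a - c| := fun x hx => by
    rwa [Metric.mem_closedBall, Real.dist_eq] at hx
  have h := (convex_closedBall c |a - c|).norm_image_sub_le_of_norm_deriv_le (f := g)
    (C := C * |a - c| ^ n) (x := c) (y := a)
    (fun x hx => hg x ((hin x hx).trans_lt ha))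
    (fun x hx => (hg' x ((hin x hx).trans_lt ha)).trans
      (mul_le_mul_of_nonneg_left (pow_le_pow_left₀ (abs_nonneg _) (hin x hx) n) hC))
    (Metric.mem_closedBall_self (abs_nonneg _))
    (by rw [Metric.mem_closedBall, Real.dist_eq])
  rw [Real.norm_eq_abs, Real.norm_eq_abs] at h
  rwa [pow_succ, ← mul_assoc]

/-- At a critical point in the interior of `[0, 1]`, a function of class `C³` has a local minimum,
or a local maximum, or varies at most like a cube. -/
lemma exists_local_behaviour {f : ℝ → ℝ} (hf : ContDiffOn ℝ 3 f (Set.Icc 0 1)) {c : ℝ}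
    (hc : c ∈ Set.Ioo (0 : ℝ) 1) (hd : deriv f c = 0) :
    IsLocalMin f c ∨ IsLocalMax f c ∨
      ∃ C r : ℝ, 0 ≤ C ∧ 0 < r ∧ ∀ a, |a - c| < r → |f a - f c| ≤ C * |a - c| ^ 3 := by
  have h0 : ContDiffOn ℝ 3 f (Set.Ioo 0 1) := hf.mono Set.Ioo_subset_Icc_self
  have h1 : ContDiffOn ℝ 2 (deriv f) (Set.Ioo 0 1) := h0.deriv_of_isOpen isOpen_Ioo (by norm_num)
  have h2 : ContDiffOn ℝ 1 (deriv (deriv f)) (Set.Ioo 0 1) :=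
    h1.deriv_of_isOpen isOpen_Ioo (by norm_num)
  have hnhds : Set.Ioo (0 : ℝ) 1 ∈ 𝓝 c := isOpen_Ioo.mem_nhds hc
  have hcont : ContinuousAt f c := (h0.contDiffAt hnhds).continuousAt
  rcases lt_trichotomy (deriv (deriv f) c) 0 with h | h | h
  · exact Or.inr (Or.inl (isLocalMax_of_deriv_deriv_neg h hd hcont))
  · refine Or.inr (Or.inr ?_)
    have hO := ((h2.contDiffAt hnhds).differentiableAt (by norm_num)).isBigO_sub
    obtain ⟨C, hC, hb⟩ := hO.exists_pos
    rw [Asymptotics.isBigOWith_iff] at hb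
    obtain ⟨r, hr, hball⟩ := Metric.eventually_nhds_iff.1 (hb.and hnhds)
    have hmem : ∀ a, |a - c| < r → a ∈ Set.Ioo (0 : ℝ) 1 := fun a ha =>
      (hball (by rwa [Real.dist_eq])).2
    have hdiff : ∀ {g : ℝ → ℝ} {n : WithTop ℕ∞}, n ≠ 0 → ContDiffOn ℝ n g (Set.Ioo 0 1) →
        ∀ a, |a - c| < r → DifferentiableAt ℝ g a := fun hn hg a ha =>
      (hg.contDiffAt (isOpen_Ioo.mem_nhds (hmem a ha))).differentiableAt hn
    have b2 : ∀ a, |a - c| < r → |deriv (deriv f) a| ≤ C * |a - c| ^ 1 := by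
      intro a ha
      have := (hball (y := a) (by rwa [Real.dist_eq])).1
      rw [h, sub_zero, Real.norm_eq_abs, Real.norm_eq_abs] at this
      rwa [pow_one]
    have b1 : ∀ a, |a - c| < r → |deriv f a| ≤ C * |a - c| ^ 2 := by
      intro a ha
      have := abs_sub_le_of_abs_deriv_le 1 hC.le (hdiff (by norm_num) h1) b2 ha
      rwa [hd, sub_zero] at this
    exact ⟨C, r, hC.le, hr, fun a ha =>
      abs_sub_le_of_abs_deriv_le 2 hC.le (hdiff (by norm_num) h0) b1 ha⟩
  · exact Or.inl (isLocalMin_of_deriv_deriv_pos h hd hcont)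

/-! ### Finite and infinite sums from the behaviour near the fixed point. -/

section Summability

variable {f : ℝ → ℝ} {p : ℝ} {s : UrnState}

lemma meanSum_ne_top_of_local_nonpos (hfc : Continuous f) (hf01 : ∀ t, f t ∈ Set.Ioo (0 : ℝ) 1)
    (hp : p ∈ Set.Icc (0 : ℝ) 1) (huniq : ∀ q ∈ Set.Icc (0 : ℝ) 1, f q = q → q = p)
    (hs : IsUrnState s) {h : UrnState → ℝ} (h1 : ∀ q, h q ≤ 1)
    (hloc : ∀ᶠ a in 𝓝 p, ∀ l, h (a, l) ≤ 0) : meanSum f s h ≠ ⊤ := by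
  obtain ⟨r, hr, hball⟩ := Metric.eventually_nhds_iff.1 hloc
  refine meanSum_ne_top_of_le hfc.measurable hs (a := 1) zero_le_one (g₂ := fun _ => 0)
    (g₃ := fun _ => 0) (measurable_far p r) measurable_const (fun q _ => ?_)
    (meanSum_far hfc hf01 hp huniq hs hr) meanSum_zero meanSum_zero
  rw [add_zero, add_zero, one_mul, far]
  split_ifs with hq
  · exact h1 q
  · exact hball (by rw [Real.dist_eq]; exact not_le.1 hq) q.2

/-- Otherwise `κ ≤ h + (1 + κ) * far` would make the constant `κ` summable along the process. -/
lemma meanSum_eq_top_of_local_pos (hfc : Continuous f) (hf01 : ∀ t, f t ∈ Set.Ioo (0 : ℝ) 1)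
    (hp : p ∈ Set.Icc (0 : ℝ) 1) (huniq : ∀ q ∈ Set.Icc (0 : ℝ) 1, f q = q → q = p)
    (hs : IsUrnState s) {h : UrnState → ℝ} (hm : Measurable h) (h1 : ∀ q, -1 ≤ h q)
    {κ : ℝ} (hκ : 0 < κ) (hloc : ∀ᶠ a in 𝓝 p, ∀ l, κ ≤ h (a, l)) : meanSum f s h = ⊤ := by
  obtain ⟨r, hr, hball⟩ := Metric.eventually_nhds_iff.1 hloc
  by_contra hcon
  have hfar : meanSum f s (fun q => (1 + κ) * far p r q) ≠ ⊤ :=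
    meanSum_ne_top_of_le hfc.measurable hs (a := 1 + κ) (by positivity) (g₂ := fun _ => 0)
      (g₃ := fun _ => 0) (measurable_far p r) measurable_const (fun q _ => by simp)
      (meanSum_far hfc hf01 hp huniq hs hr) meanSum_zero meanSum_zero
  have hmf := measurable_far p r
  have hκsum : meanSum f s (fun _ => κ) ≠ ⊤ := by
    refine meanSum_ne_top_of_le hfc.measurable hs (a := 1) zero_le_one
      (g₃ := fun _ => 0) hm (by fun_prop) (fun q _ => ?_) hcon hfar meanSum_zero
    rw [add_zero, one_mul, far]
    split_ifs with hq
    · linarith [h1 q]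
    · have := hball (by rw [Real.dist_eq]; exact not_le.1 hq) q.2
      simpa using this
  refine hκsum ?_
  simp [meanSum, hκ]

lemma meanSum_ne_top_of_local_cube (hfc : Continuous f) (hf01 : ∀ t, f t ∈ Set.Ioo (0 : ℝ) 1)
    (hp : p ∈ Set.Icc (0 : ℝ) 1) (huniq : ∀ q ∈ Set.Icc (0 : ℝ) 1, f q = q → q = p)
    (hs : IsUrnState s) {C r : ℝ} (hC : 0 ≤ C) (hr : 0 < r)
    (hcube : ∀ a, |a - p| < r → |f a - p| ≤ C * |a - p| ^ 3)
    {h : UrnState → ℝ} (h1 : ∀ q, h q ≤ 1) (hle : ∀ q, h q ≤ 2 * |f q.1 - p|) :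
    meanSum f s h ≠ ⊤ := by
  -- For `x < ρ`, `C x ^ 3 ≤ (C x) x ≤ x / 10`, the flatness required by `meanSum_cube`.
  set ρ := min r (min 1 (1 / (10 * (C + 1)))) with hρ
  have hρ0 : 0 < ρ := by positivity
  have hflat : ∀ a, |a - p| < ρ → |f a - p| ≤ |a - p| / 10 := by
    intro a ha
    have ha1 : |a - p| < r := ha.trans_le (min_le_left _ _)
    have ha2 : |a - p| ≤ 1 := (ha.trans_le ((min_le_right _ _).trans (min_le_left _ _))).le
    have ha3 : |a - p| ≤ 1 / (10 * (C + 1)) :=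
      (ha.trans_le ((min_le_right _ _).trans (min_le_right _ _))).le
    rw [le_div_iff₀ (by positivity)] at ha3
    have h0 := abs_nonneg (a - p)
    refine (hcube a ha1).trans ?_
    set x := |a - p|
    have hx2 : x ^ 2 ≤ x := by nlinarith
    have : C * x ^ 3 = C * x ^ 2 * x := by ring
    rw [this, div_eq_mul_one_div, mul_comm x (1 / 10)]
    refine mul_le_mul_of_nonneg_right ?_ h0
    nlinarith
  have hmf := measurable_far p r
  refine meanSum_ne_top_of_le hfc.measurable hs (a := 1 + 2 * C) (by positivity)
    (g₁ := far p r) (g₂ := fun q => |q.1 - p| ^ 3)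
    (g₃ := fun _ => 0) hmf (by fun_prop) (fun q _ => ?_)
    (meanSum_far hfc hf01 hp huniq hs hr) (meanSum_cube hfc hf01 hp huniq hs hρ0 hflat)
    meanSum_zero
  have h0 : 0 ≤ |q.1 - p| ^ 3 := by positivity
  rw [add_zero, far]
  split_ifs with hq
  · have := h1 q
    nlinarith
  · have := hcube q.1 (not_le.1 hq)
    have := hle q
    nlinarith

end Summability

/-! ### The theorem for continuous `f` -/

/-- Near `p` the increments exceed half of their limit value `2 p - 1 > 0`. -/
lemma meanSum_driftIncrement_of_gt {f : ℝ → ℝ} {p : ℝ} {s : UrnState} (hfc : Continuous f)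
    (hf01 : ∀ t, f t ∈ Set.Ioo (0 : ℝ) 1) (hp : p ∈ Set.Icc (0 : ℝ) 1) (hfp : f p = p)
    (huniq : ∀ q ∈ Set.Icc (0 : ℝ) 1, f q = q → q = p) (hs : IsUrnState s) (h : 1 / 2 < p) :
    meanSum f s (fun q => -driftIncrement f q) ≠ ⊤ ∧ meanSum f s (driftIncrement f) = ⊤ := by
  have hev : ∀ᶠ a in 𝓝 p, p - 1 / 2 < 2 * f a - 1 := by
    have : ContinuousAt (fun a => 2 * f a - 1) p := by fun_prop
    exact this.eventually (lt_mem_nhds (by simp only [hfp]; linarith))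
  refine ⟨meanSum_ne_top_of_local_nonpos hfc hf01 hp huniq hs
    (fun q => by unfold driftIncrement; linarith [(hf01 q.1).1]) ?_,
    meanSum_eq_top_of_local_pos hfc hf01 hp huniq hs (measurable_driftIncrement hfc.measurable)
      (fun q => by unfold driftIncrement; linarith [(hf01 q.1).1]) (κ := p - 1 / 2)
      (by linarith) ?_⟩
  · filter_upwards [hev] with a ha l
    simp only [driftIncrement]; linarith
  · filter_upwards [hev] with a ha l using ha.le

lemma meanSum_driftIncrement_of_lt {f : ℝ → ℝ} {p : ℝ} {s : UrnState} (hfc : Continuous f)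
    (hf01 : ∀ t, f t ∈ Set.Ioo (0 : ℝ) 1) (hp : p ∈ Set.Icc (0 : ℝ) 1) (hfp : f p = p)
    (huniq : ∀ q ∈ Set.Icc (0 : ℝ) 1, f q = q → q = p) (hs : IsUrnState s) (h : p < 1 / 2) :
    meanSum f s (driftIncrement f) ≠ ⊤ ∧ meanSum f s (fun q => -driftIncrement f q) = ⊤ := by
  have hev : ∀ᶠ a in 𝓝 p, 1 / 2 - p < -(2 * f a - 1) := by
    have : ContinuousAt (fun a => -(2 * f a - 1)) p := by fun_prop
    exact this.eventually (lt_mem_nhds (by simp only [hfp]; linarith))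
  refine ⟨meanSum_ne_top_of_local_nonpos hfc hf01 hp huniq hs
    (fun q => by unfold driftIncrement; linarith [(hf01 q.1).2]) ?_,
    meanSum_eq_top_of_local_pos hfc hf01 hp huniq hs
      (measurable_driftIncrement hfc.measurable).neg
      (fun q => by unfold driftIncrement; linarith [(hf01 q.1).2]) (κ := 1 / 2 - p)
      (by linarith) ?_⟩
  · filter_upwards [hev] with a ha l
    simp only [driftIncrement]; linarith
  · filter_upwards [hev] with a ha l using ha.le

lemma meanSum_driftIncrement_of_half {f : ℝ → ℝ} {s : UrnState} (hfc : Continuous f)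
    (hf01 : ∀ t, f t ∈ Set.Ioo (0 : ℝ) 1) (hfp : f (1 / 2) = 1 / 2)
    (huniq : ∀ q ∈ Set.Icc (0 : ℝ) 1, f q = q → q = 1 / 2) (hs : IsUrnState s)
    (hloc : IsLocalMin f (1 / 2) ∨ IsLocalMax f (1 / 2) ∨
      ∃ C r : ℝ, 0 ≤ C ∧ 0 < r ∧ ∀ a, |a - 1 / 2| < r → |f a - f (1 / 2)| ≤ C * |a - 1 / 2| ^ 3) :
    meanSum f s (driftIncrement f) ≠ ⊤ ∨ meanSum f s (fun q => -driftIncrement f q) ≠ ⊤ := by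
  have hp : (1 / 2 : ℝ) ∈ Set.Icc (0 : ℝ) 1 := by constructor <;> norm_num
  have hle1 : ∀ q : UrnState, driftIncrement f q ≤ 1 := fun q => by
    unfold driftIncrement; linarith [(hf01 q.1).2]
  rcases hloc with h | h | ⟨C, r, hC, hr, hcube⟩
  · refine Or.inr (meanSum_ne_top_of_local_nonpos hfc hf01 hp huniq hs
      (fun q => by unfold driftIncrement; linarith [(hf01 q.1).1]) ?_)
    filter_upwards [h] with a ha l
    rw [hfp] at ha
    simp only [driftIncrement]; linarith
  · refine Or.inl (meanSum_ne_top_of_local_nonpos hfc hf01 hp huniq hs hle1 ?_)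
    filter_upwards [h] with a ha l
    rw [hfp] at ha
    simp only [driftIncrement]; linarith
  · rw [hfp] at hcube
    refine Or.inl (meanSum_ne_top_of_local_cube hfc hf01 hp huniq hs hC hr hcube hle1 fun q => ?_)
    have := le_abs_self (f q.1 - 1 / 2)
    unfold driftIncrement
    linarith

lemma exists_le_and_le {f : ℝ → ℝ} (hf : ContinuousOn f (Set.Icc 0 1))
    (hf01 : ∀ t ∈ Set.Icc (0 : ℝ) 1, f t ∈ Set.Ioo (0 : ℝ) 1) :
    ∃ ε : ℝ, 0 < ε ∧ ∀ t ∈ Set.Icc (0 : ℝ) 1, ε ≤ f t ∧ f t ≤ 1 - ε := by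
  have hne : (Set.Icc (0 : ℝ) 1).Nonempty := ⟨0, by simp⟩
  obtain ⟨a, ha, hmin⟩ := isCompact_Icc.exists_isMinOn hne hf
  obtain ⟨b, hb, hmax⟩ := isCompact_Icc.exists_isMaxOn hne hf
  refine ⟨min (f a) (1 - f b), lt_min (hf01 a ha).1 (by linarith [(hf01 b hb).2]),
    fun t ht => ⟨(min_le_left _ _).trans (hmin ht), ?_⟩⟩
  have h1 : f t ≤ f b := hmax ht
  linarith [min_le_right (f a) (1 - f b)]

/-! ### Dependence on the values of `f` on `[0, 1]` only -/

section Congr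

variable {f g : ℝ → ℝ} {w : ℤ → UrnState}

lemma urn_congr (h : ∀ t ∈ Set.Icc (0 : ℝ) 1, f t = g t) {s : UrnState} (hs : IsUrnState s)
    (u : ℕ → unitInterval) (k : ℕ) : urn f s u k = urn g s u k := by
  induction k with
  | zero => rfl
  | succ k ih =>
    have hq := (hs.urn f u k).1
    simp only [urn]
    rw [← ih]
    simp only [urnStep, h _ hq]

lemma apply_alpha_congr (h : ∀ t ∈ Set.Icc (0 : ℝ) 1, f t = g t) (hw : ∀ x, IsUrnState (w x))
    (ω : Sample) (x : ℤ) (k : ℕ) : f (alpha f w ω x k) = g (alpha g w ω x k) := by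
  unfold alpha
  rw [h _ ((hw x).urn f _ k).1, urn_congr h (hw x)]

lemma drift_congr (h : ∀ t ∈ Set.Icc (0 : ℝ) 1, f t = g t) (hw : ∀ x, IsUrnState (w x)) :
    drift f w = drift g w := by
  funext x n ω
  simp only [drift, apply_alpha_congr h hw]

lemma driftPos_congr (h : ∀ t ∈ Set.Icc (0 : ℝ) 1, f t = g t) (hw : ∀ x, IsUrnState (w x)) :
    driftPos f w = driftPos g w := by
  funext x ω
  simp only [driftPos, apply_alpha_congr h hw]

lemma driftNeg_congr (h : ∀ t ∈ Set.Icc (0 : ℝ) 1, f t = g t) (hw : ∀ x, IsUrnState (w x)) :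
    driftNeg f w = driftNeg g w := by
  funext x ω
  simp only [driftNeg, apply_alpha_congr h hw]

lemma driftLimit_congr (h : ∀ t ∈ Set.Icc (0 : ℝ) 1, f t = g t) (hw : ∀ x, IsUrnState (w x)) :
    driftLimit f w = driftLimit g w := by
  funext x ω
  simp only [driftLimit, drift_congr h hw]

lemma driftWellDefined_congr (h : ∀ t ∈ Set.Icc (0 : ℝ) 1, f t = g t)
    (hw : ∀ x, IsUrnState (w x)) (x : ℤ) : DriftWellDefined f w x ↔ DriftWellDefined g w x := by
  simp only [DriftWellDefined, drift_congr h hw, driftPos_congr h hw, driftNeg_congr h hw,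
    driftLimit_congr h hw]

lemma recurrence_congr (h : ∀ t ∈ Set.Icc (0 : ℝ) 1, f t = g t) (hw : ∀ x, IsUrnState (w x)) :
    recurrence f w = recurrence g w := by
  have hstate : ∀ ω n, walkState f w ω n = walkState g w ω n := by
    intro ω n
    induction n with
    | zero => rfl
    | succ n ih => simp only [walkState, ih, apply_alpha_congr h hw]
  unfold recurrence walk
  simp only [hstate]

end Congr

end RRW

theorem theorem2
    (f : ℝ → ℝ)
    (hf : ContDiffOn ℝ 3 f (Set.Icc 0 1))
    (hf01 : ∀ t ∈ Set.Icc (0 : ℝ) 1, f t ∈ Set.Ioo (0 : ℝ) 1)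
    (w : ℤ → RRW.UrnState)
    (hw : ∀ x, (w x).1 ∈ Set.Icc (0 : ℝ) 1 ∧ 0 < (w x).2)
    (hright : ∀ x : ℤ, 1 ≤ x → w x = w 1)
    (hleft : ∀ x : ℤ, x ≤ -1 → w x = w (-1))
    (p : ℝ) (hp : p ∈ Set.Icc (0 : ℝ) 1) (hfp : f p = p)
    (huniq : ∀ q ∈ Set.Icc (0 : ℝ) 1, f q = q → q = p) :
    (p ≠ 1 / 2 →
      (∀ x : ℤ, RRW.DriftWellDefined f w x) ∧
      RRW.sampleMeasure (RRW.recurrence f w) = 0) ∧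
    (p = 1 / 2 → deriv f (1 / 2) = 0 →
      (∀ x : ℤ, RRW.DriftWellDefined f w x) ∧
      (1 < RRW.expectation RRW.sampleMeasure (RRW.driftLimit f w 1) ∨
          RRW.expectation RRW.sampleMeasure (RRW.driftLimit f w (-1)) < -1 →
        RRW.sampleMeasure (RRW.recurrence f w) = 0)) := by
  have hw' : ∀ x, RRW.IsUrnState (w x) := hw
  -- Nothing is known of `f` outside `[0, 1]`; this extension is globally continuous with values in
  -- `(0, 1)`, and the urns never leave `[0, 1]`.
  set g : ℝ → ℝ := fun t => f (Set.projIcc (0 : ℝ) 1 zero_le_one t) with hg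
  have hfg : ∀ t ∈ Set.Icc (0 : ℝ) 1, f t = g t := fun t ht => by
    simp only [hg, Set.projIcc_of_mem zero_le_one ht]
  have hgc : Continuous g := hf.continuousOn.comp_continuous (by fun_prop) fun t => Subtype.mem _
  have hgm := hgc.measurable
  have hg01 : ∀ t, g t ∈ Set.Ioo (0 : ℝ) 1 := fun t => hf01 _ (Subtype.mem _)
  obtain ⟨ε, hε, hb⟩ := RRW.exists_le_and_le hf.continuousOn hf01
  have hgε : ∀ t, ε ≤ g t := fun t => (hb _ (Subtype.mem _)).1
  have hg1ε : ∀ t, g t ≤ 1 - ε := fun t => (hb _ (Subtype.mem _)).2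
  have hg1 : ∀ t, g t ≤ 1 := fun t => (hg01 t).2.le
  have hgp : g p = p := by rw [← hfg p hp, hfp]
  have hguniq : ∀ q ∈ Set.Icc (0 : ℝ) 1, g q = q → q = p := fun q hq h =>
    huniq q hq (by rw [hfg q hq, h])
  simp only [RRW.driftWellDefined_congr hfg hw', RRW.recurrence_congr hfg hw',
    RRW.driftLimit_congr hfg hw']
  constructor
  · intro hne
    rcases lt_or_gt_of_ne hne with hlt | hgt
    · have h := fun x => RRW.meanSum_driftIncrement_of_lt hgc hg01 hp hgp hguniq (hw' x) hlt
      refine ⟨fun x => RRW.driftWellDefined_of_ne_top hgm (Or.inl (h x).1),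
        RRW.measure_recurrence_eq_zero_of_left hgm hε hgε hg1ε hleft ?_⟩
      rw [(h (-1)).2]
      exact (ENNReal.add_ne_top.2 ⟨ENNReal.one_ne_top, (h (-1)).1⟩).lt_top
    · have h := fun x => RRW.meanSum_driftIncrement_of_gt hgc hg01 hp hgp hguniq (hw' x) hgt
      refine ⟨fun x => RRW.driftWellDefined_of_ne_top hgm (Or.inr (h x).1),
        RRW.measure_recurrence_eq_zero_of_right hgm hε hgε hg1 hright ?_⟩
      rw [(h 1).2]
      exact (ENNReal.add_ne_top.2 ⟨ENNReal.one_ne_top, (h 1).1⟩).lt_top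
  · rintro rfl hd
    have hhalf : (1 / 2 : ℝ) ∈ Set.Ioo (0 : ℝ) 1 := by constructor <;> norm_num
    -- `1/2` is interior, so both functions have the same derivative there.
    have heq : g =ᶠ[𝓝 (1 / 2)] f := by
      filter_upwards [isOpen_Ioo.mem_nhds hhalf] with t ht
      exact (hfg t (Set.Ioo_subset_Icc_self ht)).symm
    have hgC : ContDiffOn ℝ 3 g (Set.Icc 0 1) := hf.congr fun t ht => (hfg t ht).symm
    have hloc := RRW.exists_local_behaviour hgC hhalf (by rw [heq.deriv_eq, hd])
    have h := fun x => RRW.meanSum_driftIncrement_of_half hgc hg01 hgp hguniq (hw' x) hloc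
    refine ⟨fun x => RRW.driftWellDefined_of_ne_top hgm (h x), ?_⟩
    rintro (hE | hE)
    · exact RRW.measure_recurrence_eq_zero_of_right hgm hε hgε hg1 hright
        (RRW.one_add_lt_of_one_lt_expectation hgm (h 1) hE)
    · exact RRW.measure_recurrence_eq_zero_of_left hgm hε hgε hg1ε hleft
        (RRW.one_add_lt_of_expectation_lt_neg_one hgm (h (-1)) hE)
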